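/- By a domain we mean an open bounded subset of $\mathbb{R}^d$. A domain $\Omega$ satisfies the segment condition if every $x\in\partial\Omega$ has a neighbourhood $U_x$ and a vector $y_x\neq 0$ such that $z+ty_x\in\Omega$ for all $z\in\overline{\Omega}\cap U_x$ and $0<t<1$. A finite family of nodes $P=\{x_a\}_{a\in I}\subset\mathbb{R}^d$ is an $h$-covering of a set $A\subset\mathbb{R}^d$ if every $x\in A$ lies in a (closed) $d$-simplex with vertices in $P$ whose size (the diameter of the smallest ball containing it) is less than $h$. It has $h$-density bounded by $\tau$ if every closed ball of radius $h$ in $\mathbb{R}^d$ contains at most $\tau$ of the nodes. For $\beta>0$, an LME (local maximum-entropy) approximation scheme $\{I,W,P\}$ in a domain $\Omega'$ with parameter $\beta$ consists of such nodes and of shape functions $W=\{w_a\}_{a\in I}$ such that for every $x\in\Omega'$ the vector $(w_a(x))_{a\in I}$ minimizes $$\sum_{a\in I} q_a|x-x_a|^2+\frac1\beta\sum_{a\in I}q_a\log q_a\qquad(0\log 0=0)$$ among all $q\in\mathbb{R}^I$ with $q_a\ge 0$, $\sum_a q_a=1$ and $\sum_a q_a x_a=x$. **Corollary.** Let $\Omega$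 be a domain satisfying the segment condition and let $\Omega'$ be a domain with $\overline{\Omega}\subset\Omega'$. Let $\gamma,\tau>0$, let $h_k>0$ with $h_k\to 0$, and let $\{I_k,W_k,P_k\}$, $k\in\mathbb{N}$, be LME approximation schemes in $\Omega'$ with parameters $\beta_k=\gamma/h_k^2$ such that, for every $k$, $P_k$ is an $h_k$-covering of $\Omega'$ and has $h_k$-density bounded by $\tau$. Let $X_k$ be the linear span of $W_k$, and let $1\le p<\infty$. Then for every $u\in W^{1,p}(\Omega)$ there is a sequence $u_k\in X_k$ such that $u_k|_\Omega\in W^{1,p}(\Omega)$ for every $k$ and $u_k|_\Omega\to u$ in $W^{1,p}(\Omega)$. -/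

import Mathlib

open MeasureTheory Filter Topology
open scoped ENNReal ContDiff

noncomputable section

namespace LME

/-- `ℝ^d` with the Euclidean norm. -/
abbrev Space (d : ℕ) : Type := EuclideanSpace ℝ (Fin d)

/-! ### Domains -/

/-- A domain is an open and bounded subset of `ℝ^d`. -/
def IsBoundedDomain {d : ℕ} (Ω : Set (Space d)) : Prop :=
  IsOpen Ω ∧ Bornology.IsBounded Ω

/-- The segment condition: every boundary point `x` has a neighbourhood `U` and a direction
`y ≠ 0` such that `z + t y ∈ Ω` for all `z ∈ closure Ω ∩ U` and all `0 < t < 1`. -/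
def SegmentCondition {d : ℕ} (Ω : Set (Space d)) : Prop :=
  ∀ x ∈ frontier Ω, ∃ U ∈ 𝓝 x, ∃ y : Space d, y ≠ 0 ∧
    ∀ z ∈ closure Ω ∩ U, ∀ t : ℝ, 0 < t → t < 1 → z + t • y ∈ Ω

/-! ### Point sets -/

/-- The size of a bounded set: the diameter of the smallest (closed) ball that contains it. -/
def size {d : ℕ} (A : Set (Space d)) : ℝ :=
  2 * sInf {r : ℝ | 0 ≤ r ∧ ∃ c : Space d, A ⊆ Metric.closedBall c r}

/-- `P` is an `h`-covering of `A`: every point of `A` lies in a `d`-simplex of size `< h` whose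
vertices belong to `P`. -/
def IsCovering {d : ℕ} (h : ℝ) (P A : Set (Space d)) : Prop :=
  ∀ x ∈ A, ∃ v : Fin (d + 1) → Space d, AffineIndependent ℝ v ∧ (∀ i, v i ∈ P) ∧
    size (convexHull ℝ (Set.range v)) < h ∧ x ∈ convexHull ℝ (Set.range v)

/-! ### Approximation schemes -/

/-- An approximation scheme `{I, W, P}` on `ℝ^d`: a finite index set `I`, nodes `x_a` and shape
functions `w_a`, `a ∈ I`. The shape functions are total functions, of which only the values on the
domain under consideration matter. -/
structure ApproximationScheme (d : ℕ) where
  /-- the index set -/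
  Index : Type
  /-- the index set is finite -/
  fintypeIndex : Fintype Index
  /-- the nodes -/
  node : Index → Space d
  /-- the shape functions -/
  shape : Index → Space d → ℝ

attribute [instance] ApproximationScheme.fintypeIndex

namespace ApproximationScheme

variable {d : ℕ}

/-- The point set `P` of the nodes. -/
def points (S : ApproximationScheme d) : Set (Space d) := Set.range S.node

/-- The space `X` of functions spanned by the shape functions. -/
def space (S : ApproximationScheme d) : Submodule ℝ (Space d → ℝ) :=
  Submodule.span ℝ (Set.range S.shape)

/-- The nodes have `h`-density bounded by `τ`: every closed ball of radius `h` holds at most `τ`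
of them (a node that is listed several times counts several times). -/
def HasDensityBound (S : ApproximationScheme d) (h τ : ℝ) : Prop :=
  ∀ x : Space d, (Nat.card {a : S.Index // S.node a ∈ Metric.closedBall x h} : ℝ) ≤ τ

/-- The feasible set of the local maximum-entropy problem at `x`: weights `q_a ≥ 0` with
`∑ q_a = 1` and `∑ q_a x_a = x`. -/
def feasible (S : ApproximationScheme d) (x : Space d) : Set (S.Index → ℝ) :=
  {q | (∀ a, 0 ≤ q a) ∧ ∑ a, q a = 1 ∧ ∑ a, q a • S.node a = x}

/-- The objective of the local maximum-entropy problem at `x`,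
`f_β(x, q) = ∑ q_a |x - x_a|² + β⁻¹ ∑ q_a log q_a`, with `0 log 0 = 0`. -/
def objective (S : ApproximationScheme d) (β : ℝ) (x : Space d) (q : S.Index → ℝ) : ℝ :=
  ∑ a, q a * ‖x - S.node a‖ ^ 2 + 1 / β * ∑ a, q a * Real.log (q a)

/-- `S` is a local maximum-entropy (LME) scheme with parameter `β` in the domain `Ω`: at every
`x ∈ Ω` the values `(w_a(x))_a` solve the minimization problem at `x`. -/
def IsLME (S : ApproximationScheme d) (β : ℝ) (Ω : Set (Space d)) : Prop :=
  ∀ x ∈ Ω, (fun a => S.shape a x) ∈ S.feasible x ∧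
    IsMinOn (S.objective β x) (S.feasible x) (fun a => S.shape a x)

end ApproximationScheme

/-! ### The Sobolev space `W^{1,p}(Ω)` -/

/-- `g` is the weak `i`-th partial derivative of `u` in the open set `Ω`. Both functions are
defined on all of `ℝ^d`, but only their restrictions to `Ω` matter. -/
def HasWeakPartialDeriv {d : ℕ} (Ω : Set (Space d)) (i : Fin d) (u g : Space d → ℝ) : Prop :=
  LocallyIntegrableOn u Ω volume ∧ LocallyIntegrableOn g Ω volume ∧
    ∀ φ : Space d → ℝ, ContDiff ℝ ∞ φ → HasCompactSupport φ → tsupport φ ⊆ Ω →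
      ∫ x in Ω, u x * fderiv ℝ φ x (EuclideanSpace.single i 1) = -∫ x in Ω, g x * φ x

/-- `u ∈ W^{1,p}(Ω)`: `u` and its weak first partial derivatives belong to `L^p(Ω)`. -/
def MemW1p {d : ℕ} (Ω : Set (Space d)) (p : ℝ≥0∞) (u : Space d → ℝ) : Prop :=
  MemLp u p (volume.restrict Ω) ∧
    ∀ i : Fin d, ∃ g : Space d → ℝ, HasWeakPartialDeriv Ω i u g ∧ MemLp g p (volume.restrict Ω)

/-- The `W^{1,p}(Ω)` norm `(‖u‖_p ^ p + ∑ i, ‖∂_i u‖_p ^ p)^{1/p}`, `1 ≤ p < ∞`, as an extended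
nonnegative number. The weak derivative `∂_i u` is unique up to null sets, so the infimum runs over
equal numbers; it is `∞` where there is no weak derivative. -/
def eW1pNorm {d : ℕ} (Ω : Set (Space d)) (p : ℝ≥0∞) (u : Space d → ℝ) : ℝ≥0∞ :=
  (eLpNorm u p (volume.restrict Ω) ^ p.toReal +
    ∑ i : Fin d, (⨅ (g : Space d → ℝ) (_ : HasWeakPartialDeriv Ω i u g),
      eLpNorm g p (volume.restrict Ω)) ^ p.toReal) ^ (1 / p.toReal)

end LME

end

namespace LME

/-! The proof has two halves: smooth functions are dense in `W^{1,p}(Ω)`, and a smooth compactly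
supported `v` is approximated to first order by its interpolant `∑ v(x_a) w_a`, with errors of order
`h` in values and gradients on `Ω`.

Density (`exists_smooth_approx`). A partition of unity splits `u` into pieces `ψ u`. Extended by
zero, a piece may fail to be weakly differentiable across the boundary. The segment condition
supplies a direction `y` such that, for small `t > 0`, the point `x + t y` with `x ∈ Ω` keeps a
positive distance from the part of `tsupport ψ` outside `Ω`. A fine mollification at `x + t y` then
sees only values from inside `Ω`, and converges in `L^p` together with its gradient.

Interpolation (`exists_shape_bounds`, `exists_interpolant_bounds`). Strictness in Gibbs' inequality
identifies the LME weights with an exponential family with Gaussian base weights. After rescaling by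
`h` around a point, the density bound controls Gaussian sums and the covering puts a node near every
point of a ball of radius 2. Hence the third moment is bounded and the covariance `J` is bounded
below, uniformly in the scheme. By the inverse function theorem the rescaled weights have derivative
`w_a ⟨y_a, J⁻¹ e⟩`. The moment identities cancel the Taylor terms of orders 0 and 1, and the third
moment bounds the remainder.

Combining both halves gives every accuracy `ε` for all large `k`; `exists_selection_tendsto_zero`
extracts one sequence. -/

/-! ### Translations and averages in `L^p`. -/

theorem tendsto_eLpNorm_translate_sub {d : ℕ} {p : ℝ≥0∞} (hp : 1 ≤ p) (hp' : p ≠ ⊤)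
    {f : Space d → ℝ} (hf : MemLp f p volume) :
    Tendsto (fun w : Space d => eLpNorm (fun x => f (x - w) - f x) p volume) (𝓝 0) (𝓝 0) := by
  have : Fact (1 ≤ p) := ⟨hp⟩
  -- Composition with measure-preserving maps is continuous in `L^p` when the maps vary continuously
  -- in the compact-open topology; currying gives this for translations.
  let g : C(Space d, C(Space d, Space d)) :=
    (ContinuousMap.mk (fun a : Space d × Space d => a.2 - a.1) (by fun_prop)).curry
  have hg : ∀ w, MeasurePreserving (g w) volume volume := fun w =>
    measurePreserving_sub_right volume w
  have hc : Continuous fun w => Lp.compMeasurePreserving (g w) (hg w) (hf.toLp f) :=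
    continuous_const.compMeasurePreservingLp g.continuous hg hp'
  have h0 : Lp.compMeasurePreserving (g 0) (hg 0) (hf.toLp f) = hf.toLp f := by
    ext1
    refine (Lp.coeFn_compMeasurePreserving _ (hg 0)).trans ?_
    refine Eventually.of_forall fun x => ?_
    simp [g]
  have h1 := tendsto_iff_edist_tendsto_0.1 (hc.tendsto 0)
  rw [h0] at h1
  refine h1.congr fun w => ?_
  rw [Lp.edist_def]
  refine eLpNorm_congr_ae ?_
  filter_upwards [Lp.coeFn_compMeasurePreserving (hf.toLp f) (hg w), hf.coeFn_toLp,
    (hg w).quasiMeasurePreserving.ae hf.coeFn_toLp] with x h1 h2 h3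
  simp only [Pi.sub_apply, h1, h2, Function.comp, h3]
  simp [g]

/-- Averaging a function over small translations is close to the identity in `L^p`. -/
theorem eLpNorm_integral_translate_sub_le {d : ℕ} {p : ℝ≥0∞} (hp : 1 ≤ p) (hp' : p ≠ ⊤)
    {f : Space d → ℝ} (hfm : StronglyMeasurable f)
    (ν : Measure (Space d)) [IsProbabilityMeasure ν] {ε : ℝ≥0∞}
    (hε : ∀ᵐ w ∂ν, eLpNorm (fun x => f (x - w) - f x) p volume ≤ ε)
    (hi : ∀ x, Integrable (fun w => f (x - w)) ν) :
    eLpNorm (fun x => (∫ w, f (x - w) ∂ν) - f x) p volume ≤ ε := by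
  have hp0 : p ≠ 0 := (zero_lt_one.trans_le hp).ne'
  have hpr : 0 < p.toReal := ENNReal.toReal_pos hp0 hp'
  -- Jensen's inequality, as the comparison of `L^1` and `L^p` norms under a probability measure.
  -- Tonelli then moves the `x`-integral inside.
  have key : ∀ x, ‖(∫ w, f (x - w) ∂ν) - f x‖ₑ ^ p.toReal
      ≤ ∫⁻ w, ‖f (x - w) - f x‖ₑ ^ p.toReal ∂ν := by
    intro x
    have h1 : (∫ w, f (x - w) ∂ν) - f x = ∫ w, (f (x - w) - f x) ∂ν := by
      rw [integral_sub (hi x) (integrable_const _)]; simp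
    have h2 : ‖∫ w, (f (x - w) - f x) ∂ν‖ₑ ≤ eLpNorm (fun w => f (x - w) - f x) p ν := by
      refine (enorm_integral_le_lintegral_enorm _).trans ?_
      rw [← eLpNorm_one_eq_lintegral_enorm]
      exact eLpNorm_le_eLpNorm_of_exponent_le hp
        ((hi x).sub (integrable_const _)).aestronglyMeasurable
    rw [h1]
    refine (ENNReal.rpow_le_rpow h2 hpr.le).trans ?_
    rw [eLpNorm_eq_lintegral_rpow_enorm_toReal hp0 hp', ← ENNReal.rpow_mul,
      one_div_mul_cancel hpr.ne', ENNReal.rpow_one]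
  have hmeas : Measurable (Function.uncurry fun (x w : Space d) =>
      ‖f (x - w) - f x‖ₑ ^ p.toReal) := by
    have : Measurable f := hfm.measurable
    unfold Function.uncurry
    fun_prop
  rw [eLpNorm_eq_lintegral_rpow_enorm_toReal hp0 hp']
  have hle : ∫⁻ x, ‖(∫ w, f (x - w) ∂ν) - f x‖ₑ ^ p.toReal ≤ ε ^ p.toReal := by
    calc _ ≤ ∫⁻ x, ∫⁻ w, ‖f (x - w) - f x‖ₑ ^ p.toReal ∂ν := lintegral_mono key
      _ = ∫⁻ w, ∫⁻ x, ‖f (x - w) - f x‖ₑ ^ p.toReal ∂volume ∂ν :=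
        lintegral_lintegral_swap hmeas.aemeasurable
      _ ≤ ∫⁻ w, ε ^ p.toReal ∂ν := by
        refine lintegral_mono_ae ?_
        filter_upwards [hε] with w hw
        refine le_trans (le_of_eq ?_) (ENNReal.rpow_le_rpow hw hpr.le)
        rw [eLpNorm_eq_lintegral_rpow_enorm_toReal hp0 hp', ← ENNReal.rpow_mul,
          one_div_mul_cancel hpr.ne', ENNReal.rpow_one]
      _ = ε ^ p.toReal := by simp
  refine (ENNReal.rpow_le_rpow hle (by positivity)).trans ?_
  rw [← ENNReal.rpow_mul, mul_one_div_cancel hpr.ne', ENNReal.rpow_one]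

/-- The substitution `w = x - z` turns the shifted kernel into the density of a probability measure
on the ball of radius `φ.rOut` about `-a`, so only translations shorter than `φ.rOut + ‖a‖` enter
the average. -/
theorem eLpNorm_bump_average_sub_le_of_stronglyMeasurable {d : ℕ} {p : ℝ≥0∞} (hp : 1 ≤ p)
    (hp' : p ≠ ⊤) {f : Space d → ℝ} (hfm : StronglyMeasurable f) (hfi : Integrable f volume)
    (φ : ContDiffBump (0 : Space d)) (a : Space d) {ε : ℝ≥0∞}
    (hε : ∀ w, ‖w‖ < φ.rOut + ‖a‖ → eLpNorm (fun x => f (x - w) - f x) p volume ≤ ε) :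
    eLpNorm (fun x => (∫ z, f z * φ.normed volume (x + a - z)) - f x) p volume ≤ ε := by
  set K : Space d → ℝ := fun w => φ.normed volume (w + a) with hK
  have hKc : Continuous K := φ.continuous_normed.comp (by fun_prop)
  have hK0 : ∀ w, 0 ≤ K w := fun w => φ.nonneg_normed _
  have hKi : Integrable K volume := φ.integrable_normed.comp_add_right a
  set ν : Measure (Space d) := volume.withDensity fun w => ENNReal.ofReal (K w) with hν
  have hν1 : IsProbabilityMeasure ν := by
    constructor
    rw [hν, withDensity_apply _ MeasurableSet.univ, Measure.restrict_univ,
      ← ofReal_integral_eq_lintegral_ofReal hKi (Eventually.of_forall hK0)]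
    have : ∫ x, K x = 1 := by
      rw [hK, integral_add_right_eq_self (fun w => φ.normed volume w) a, φ.integral_normed]
    simp [this]
  have hmeas : Measurable fun w => ENNReal.ofReal (K w) := hKc.measurable.ennreal_ofReal
  have hlt : ∀ᵐ w, ENNReal.ofReal (K w) < ⊤ := Eventually.of_forall fun _ => ENNReal.ofReal_lt_top
  have hint : ∀ x, ∫ w, f (x - w) ∂ν = ∫ z, f z * φ.normed volume (x + a - z) := by
    intro x
    rw [hν, integral_withDensity_eq_integral_toReal_smul hmeas hlt,
      ← integral_sub_left_eq_self _ volume x]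
    refine integral_congr_ae (Eventually.of_forall fun w => ?_)
    simp only [smul_eq_mul, hK, sub_sub_cancel]
    rw [mul_comm, sub_add_eq_add_sub, ENNReal.toReal_ofReal (φ.nonneg_normed _)]
  have hi : ∀ x, Integrable (fun w => f (x - w)) ν := by
    intro x
    rw [hν, integrable_withDensity_iff_integrable_smul' hmeas hlt]
    obtain ⟨C, hC⟩ := φ.hasCompactSupport_normed (μ := volume) |>.exists_bound_of_continuous
      φ.continuous_normed
    refine (hfi.comp_sub_left x).bdd_mul (c := C) ?_ (Eventually.of_forall fun w => ?_)
    · exact hmeas.ennreal_toReal.aestronglyMeasurable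
    · rw [ENNReal.toReal_ofReal (hK0 _)]
      exact hC _
  rw [show (fun x => (∫ z, f z * φ.normed volume (x + a - z)) - f x) =
    fun x => (∫ w, f (x - w) ∂ν) - f x from funext fun x => by rw [hint]]
  refine eLpNorm_integral_translate_sub_le hp hp' hfm ν ?_ hi
  rw [hν, ae_withDensity_iff hmeas]
  refine Eventually.of_forall fun w hw => hε w ?_
  have h1 : w + a ∈ Function.support (φ.normed volume) := by
    intro h
    exact hw (by simp [hK, h])
  rw [φ.support_normed_eq] at h1
  have h2 : ‖w + a‖ < φ.rOut := by simpa using h1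
  calc ‖w‖ = ‖(w + a) - a‖ := by simp
    _ ≤ ‖w + a‖ + ‖a‖ := norm_sub_le _ _
    _ < _ := by linarith

/-- Averaging against a shifted smooth bump is close to the identity in `L^p`. -/
theorem exists_eLpNorm_bump_average_sub_le {d : ℕ} {p : ℝ≥0∞} (hp : 1 ≤ p) (hp' : p ≠ ⊤)
    {f : Space d → ℝ} (hf : MemLp f p volume) (hfi : Integrable f volume) {ε : ℝ≥0∞}
    (hε : ε ≠ 0) :
    ∃ δ > 0, ∀ (φ : ContDiffBump (0 : Space d)) (a : Space d), φ.rOut < δ → ‖a‖ < δ →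
      eLpNorm (fun x => (∫ z, f z * φ.normed volume (x + a - z)) - f x) p volume ≤ ε := by
  -- Tonelli needs joint measurability of `f (x - w)`, hence a strongly measurable representative.
  obtain ⟨g, hgm, hfg⟩ := hf.1
  have hg : MemLp g p volume := hf.ae_eq hfg
  obtain ⟨δ, hδ, H⟩ := Metric.eventually_nhds_iff.1
    ((tendsto_eLpNorm_translate_sub hp hp' hg).eventually (ge_mem_nhds hε.bot_lt))
  refine ⟨δ / 2, by positivity, fun φ a hφ ha => ?_⟩
  have h1 := eLpNorm_bump_average_sub_le_of_stronglyMeasurable hp hp' hgm (hfi.congr hfg) φ a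
    (ε := ε) fun w hw => H (by rw [dist_zero_right]; linarith)
  refine le_trans (le_of_eq (eLpNorm_congr_ae ?_)) h1
  filter_upwards [hfg] with x hx
  have : ∫ z, f z * φ.normed volume (x + a - z) = ∫ z, g z * φ.normed volume (x + a - z) := by
    refine integral_congr_ae ?_
    filter_upwards [hfg] with z hz
    rw [hz]
  rw [hx, this]

/-! ### Density of smooth functions under the segment condition. -/

theorem integrable_mul_of_continuous_hasCompactSupport {d : ℕ} {μ : Measure (Space d)}
    {f k : Space d → ℝ} (hf : Integrable f μ) (hk : Continuous k) (hk' : HasCompactSupport k) :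
    Integrable (fun z => f z * k z) μ := by
  obtain ⟨C, hC⟩ := hk'.exists_bound_of_continuous hk
  exact hf.mul_bdd hk.aestronglyMeasurable (Eventually.of_forall hC)

theorem memLp_mul_of_continuous_hasCompactSupport {d : ℕ} {μ : Measure (Space d)} {p : ℝ≥0∞}
    {f k : Space d → ℝ} (hf : MemLp f p μ) (hk : Continuous k) (hk' : HasCompactSupport k) :
    MemLp (fun z => k z * f z) p μ := by
  obtain ⟨C, hC⟩ := hk'.exists_bound_of_continuous hk
  exact hf.of_le_mul (c := C) (hk.aestronglyMeasurable.mul hf.1)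
    (Eventually.of_forall fun x => by
      rw [norm_mul]; exact mul_le_mul_of_nonneg_right (hC x) (norm_nonneg _))

/-- This is the convolution of `f` with `ρ`, evaluated at `x + a`; derivatives fall on the smooth
kernel. -/
theorem shifted_convolution_regularity {d : ℕ} {f ρ : Space d → ℝ} (hf : Integrable f volume)
    (hf' : HasCompactSupport f) (hρ : ContDiff ℝ ∞ ρ) (hρ' : HasCompactSupport ρ) (a : Space d) :
    ContDiff ℝ ∞ (fun x => ∫ z, f z * ρ (x + a - z)) ∧
      HasCompactSupport (fun x => ∫ z, f z * ρ (x + a - z)) ∧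
      ∀ x e, fderiv ℝ (fun x => ∫ z, f z * ρ (x + a - z)) x e =
        ∫ z, f z * fderiv ℝ ρ (x + a - z) e := by
  set c : Space d → ℝ := convolution f ρ (ContinuousLinearMap.mul ℝ ℝ) volume with hc
  have hv : (fun x => ∫ z, f z * ρ (x + a - z)) = fun x => c (x + a) := by
    funext x
    simp [hc, convolution_def]
  have hl := hf.locallyIntegrable
  have h1 : ContDiff ℝ ∞ c := hρ'.contDiff_convolution_right _ hl hρ
  have h2 : HasCompactSupport c := hf'.convolution _ hρ'
  have hρ1 : ContDiff ℝ 1 ρ := hρ.of_le (by exact_mod_cast le_top)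
  rw [hv]
  refine ⟨h1.comp (by fun_prop), h2.comp_homeomorph (Homeomorph.addRight a), fun x e => ?_⟩
  rw [fderiv_comp_add_right a, (hρ'.hasFDerivAt_convolution_right _ hl hρ1 (x + a)).fderiv,
    convolution_precompR_apply _ hl (hρ'.fderiv ℝ) (hρ1.continuous_fderiv one_ne_zero)]
  simp [convolution_def]

/-- Testing a weak derivative of `u` against a kernel cut off by `ψ` yields the weak derivative
of `ψ u`. -/
theorem integral_cutoff_mul_fderiv_kernel {d : ℕ} {Ω : Set (Space d)} {u g : Space d → ℝ}
    {i : Fin d} (hu : IntegrableOn u Ω volume) (hg : IntegrableOn g Ω volume)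
    (hug : HasWeakPartialDeriv Ω i u g) {ψ ρ : Space d → ℝ} (hψ : ContDiff ℝ ∞ ψ)
    (hψ' : HasCompactSupport ψ) (hρ : ContDiff ℝ ∞ ρ) (b : Space d)
    (hb : ∀ z ∈ tsupport ψ, b - z ∈ tsupport ρ → z ∈ Ω) :
    ∫ z in Ω, ψ z * u z * fderiv ℝ ρ (b - z) (EuclideanSpace.single i 1) =
      ∫ z in Ω, (ψ z * g z + fderiv ℝ ψ z (EuclideanSpace.single i 1) * u z) * ρ (b - z) := by
  set e : Space d := EuclideanSpace.single i 1
  have hρb : ContDiff ℝ ∞ fun z => ρ (b - z) := hρ.comp (by fun_prop)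
  have hψd : Continuous fun z => fderiv ℝ ψ z e :=
    (hψ.continuous_fderiv (by simp)).clm_apply continuous_const
  have hρd : Continuous fun z => fderiv ℝ ρ (b - z) e :=
    ((hρ.continuous_fderiv (by simp)).comp (by fun_prop)).clm_apply continuous_const
  have hψd' : HasCompactSupport fun z => fderiv ℝ ψ z e := hψ'.fderiv_apply ℝ e
  have hfd : ∀ z, fderiv ℝ (fun z => ρ (b - z) * ψ z) z e =
      ρ (b - z) * fderiv ℝ ψ z e - ψ z * fderiv ℝ ρ (b - z) e := by
    intro z
    have h1 : HasFDerivAt (fun z => ρ (b - z))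
        ((fderiv ℝ ρ (b - z)).comp (-ContinuousLinearMap.id ℝ (Space d))) z :=
      ((hρ.differentiable (by simp)) (b - z)).hasFDerivAt.comp z
        ((hasFDerivAt_id z).const_sub b)
    have h2 := ((hψ.differentiable (by simp)) z).hasFDerivAt
    rw [(h1.fun_mul h2).fderiv]
    simp
    ring
  have hsub : tsupport (fun z => ρ (b - z) * ψ z) ⊆ Ω := by
    have hcl : IsClosed {z | z ∈ tsupport ψ ∧ b - z ∈ tsupport ρ} :=
      (isClosed_tsupport _).inter ((isClosed_tsupport _).preimage (by fun_prop))
    refine (closure_minimal (fun z hz => ?_) hcl).trans fun z hz => hb z hz.1 hz.2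
    have hz' : ρ (b - z) * ψ z ≠ 0 := hz
    exact ⟨subset_tsupport _ (right_ne_zero_of_mul hz'),
      subset_tsupport _ (left_ne_zero_of_mul hz')⟩
  -- The test function is `ρ (b - z) * ψ z`, whose support lies in `Ω` by `hb`. Reflection in the
  -- kernel supplies the sign, and the term where `ψ` is differentiated becomes the `u ∂ψ` part of
  -- the derivative of `ψ u`.
  have key : ∫ z in Ω, u z * fderiv ℝ (fun z => ρ (b - z) * ψ z) z e =
      -∫ z in Ω, g z * (ρ (b - z) * ψ z) :=
    hug.2.2 (fun z => ρ (b - z) * ψ z) (hρb.mul hψ) hψ'.mul_left hsub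
  simp only [hfd] at key
  have i1 : IntegrableOn (fun z => u z * (ρ (b - z) * fderiv ℝ ψ z e)) Ω volume :=
    integrable_mul_of_continuous_hasCompactSupport hu (hρb.continuous.mul hψd) hψd'.mul_left
  have i2 : IntegrableOn (fun z => u z * (ψ z * fderiv ℝ ρ (b - z) e)) Ω volume :=
    integrable_mul_of_continuous_hasCompactSupport hu (hψ.continuous.mul hρd) hψ'.mul_right
  have i3 : IntegrableOn (fun z => g z * (ρ (b - z) * ψ z)) Ω volume :=
    integrable_mul_of_continuous_hasCompactSupport hg (hρb.continuous.mul hψ.continuous)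
      hψ'.mul_left
  simp only [mul_sub] at key
  rw [integral_sub i1 i2] at key
  have e1 : ∫ z in Ω, (ψ z * g z + fderiv ℝ ψ z e * u z) * ρ (b - z) =
      (∫ z in Ω, g z * (ρ (b - z) * ψ z)) + ∫ z in Ω, u z * (ρ (b - z) * fderiv ℝ ψ z e) := by
    rw [← integral_add i3 i1]
    congr 1 with z
    ring
  have e2 : ∫ z in Ω, ψ z * u z * fderiv ℝ ρ (b - z) e =
      ∫ z in Ω, u z * (ψ z * fderiv ℝ ρ (b - z) e) := by
    congr 1 with z
    ring
  rw [e1, e2]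
  linarith

/-- If `Ω` can be moved away from the part of its complement seen by the cut-off function `ψ`,
then `ψ u` can be approximated by smooth functions in `W^{1,p}(Ω)`. -/
theorem exists_smooth_approx_cutoff_mul {d : ℕ} {Ω : Set (Space d)} (hΩ : IsBoundedDomain Ω)
    {p : ℝ≥0∞} (hp : 1 ≤ p) (hp' : p ≠ ⊤) {u : Space d → ℝ} {g : Fin d → Space d → ℝ}
    (hu : MemLp u p (volume.restrict Ω)) (hug : ∀ i, HasWeakPartialDeriv Ω i u (g i))
    (hg : ∀ i, MemLp (g i) p (volume.restrict Ω)) {ψ : Space d → ℝ} (hψ : ContDiff ℝ ∞ ψ)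
    (hψ' : HasCompactSupport ψ) {y : Space d}
    (hy : ∀ᶠ t in 𝓝[>] (0 : ℝ), ∀ z ∈ closure Ω, z + t • y ∈ tsupport ψ → z + t • y ∈ Ω)
    {ε : ℝ≥0∞} (hε : ε ≠ 0) :
    ∃ v : Space d → ℝ, ContDiff ℝ ∞ v ∧ HasCompactSupport v ∧
      eLpNorm (fun x => v x - ψ x * u x) p (volume.restrict Ω) ≤ ε ∧
      ∀ i, eLpNorm (fun x => fderiv ℝ v x (EuclideanSpace.single i 1) -
        (ψ x * g i x + fderiv ℝ ψ x (EuclideanSpace.single i 1) * u x)) p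
          (volume.restrict Ω) ≤ ε := by
  have hfin : IsFiniteMeasure (volume.restrict Ω) := by
    rw [isFiniteMeasure_restrict]
    exact hΩ.2.measure_lt_top.ne
  have hm : MeasurableSet Ω := hΩ.1.measurableSet
  set F : Space d → ℝ := Ω.indicator fun x => ψ x * u x with hF
  set G : Fin d → Space d → ℝ := fun i => Ω.indicator fun x =>
    ψ x * g i x + fderiv ℝ ψ x (EuclideanSpace.single i 1) * u x with hG
  have hFr : MemLp (fun x => ψ x * u x) p (volume.restrict Ω) :=
    memLp_mul_of_continuous_hasCompactSupport hu hψ.continuous hψ'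
  have hGr : ∀ i, MemLp (fun x => ψ x * g i x + fderiv ℝ ψ x (EuclideanSpace.single i 1) * u x) p
      (volume.restrict Ω) := fun i =>
    (memLp_mul_of_continuous_hasCompactSupport (hg i) hψ.continuous hψ').add
      (memLp_mul_of_continuous_hasCompactSupport hu
        ((hψ.continuous_fderiv (by simp)).clm_apply continuous_const) (hψ'.fderiv_apply ℝ _))
  have hFm : MemLp F p volume := (memLp_indicator_iff_restrict hm).2 hFr
  have hGm : ∀ i, MemLp (G i) p volume := fun i => (memLp_indicator_iff_restrict hm).2 (hGr i)
  have hFi : Integrable F volume := (integrable_indicator_iff hm).2 (hFr.integrable hp)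
  have hGi : ∀ i, Integrable (G i) volume := fun i =>
    (integrable_indicator_iff hm).2 ((hGr i).integrable hp)
  have hFc : HasCompactSupport F := hψ'.mono fun x hx => by
    have h1 := Set.indicator_apply_ne_zero.1 hx
    exact left_ne_zero_of_mul h1.2
  obtain ⟨δ, hδ, H⟩ := exists_eLpNorm_bump_average_sub_le hp hp' hFm hFi hε
  choose δ' hδ' H' using fun i => exists_eLpNorm_bump_average_sub_le hp hp' (hGm i) (hGi i) hε
  have hsmall : ∀ᶠ t in 𝓝[>] (0 : ℝ), ‖t • y‖ < δ ∧ ∀ i, ‖t • y‖ < δ' i := by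
    have hc : Tendsto (fun t : ℝ => ‖t • y‖) (𝓝[>] 0) (𝓝 0) := by
      have : Continuous fun t : ℝ => ‖t • y‖ := by fun_prop
      simpa using (this.tendsto 0).mono_left nhdsWithin_le_nhds
    exact (hc.eventually (gt_mem_nhds hδ)).and
      (eventually_all.2 fun i => hc.eventually (gt_mem_nhds (hδ' i)))
  obtain ⟨t, ht1, ht2, ht3⟩ := (hy.and hsmall).exists
  -- The shifted closure is compact and the forbidden set `tsupport ψ \ Ω` is closed, so
  -- disjointness leaves a gap `η`. A kernel of radius `r < η` centred at `x + t • y` cannot reach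
  -- the forbidden set.
  have hdis : Disjoint ((fun z => z + t • y) '' closure Ω) (tsupport ψ \ Ω) := by
    rw [Set.disjoint_left]
    rintro _ ⟨z, hz, rfl⟩ ⟨h1, h2⟩
    exact h2 (ht1 z hz h1)
  have hcpt : IsCompact ((fun z => z + t • y) '' closure Ω) :=
    hΩ.2.isCompact_closure.image (by fun_prop)
  obtain ⟨η, hη, hdis'⟩ := hdis.exists_cthickenings hcpt
    ((isClosed_tsupport ψ).sdiff hΩ.1)
  obtain ⟨r, hr0, hr⟩ : ∃ r > 0, r < δ ∧ r < η ∧ ∀ i, r < δ' i := by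
    have : ∀ᶠ r in 𝓝[>] (0 : ℝ), r < δ ∧ r < η ∧ ∀ i, r < δ' i :=
      nhdsWithin_le_nhds ((gt_mem_nhds hδ).and ((gt_mem_nhds hη).and
        (eventually_all.2 fun i => gt_mem_nhds (hδ' i))))
    obtain ⟨r, h1, h2⟩ := (this.and self_mem_nhdsWithin).exists
    exact ⟨r, h2, h1⟩
  let φ : ContDiffBump (0 : Space d) := ⟨r / 2, r, by positivity, by linarith⟩
  have hρ : ContDiff ℝ ∞ (φ.normed volume) := φ.contDiff_normed
  obtain ⟨hv1, hv2, hv3⟩ := shifted_convolution_regularity hFi hFc hρ φ.hasCompactSupport_normed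
    (t • y)
  refine ⟨_, hv1, hv2, ?_, fun i => ?_⟩
  · refine le_trans ?_ ((eLpNorm_restrict_le _ p volume Ω).trans (H φ (t • y) hr.1 ht2))
    refine le_of_eq (eLpNorm_congr_ae ?_)
    filter_upwards [ae_restrict_mem hm] with x hx
    simp [hF, hx]
  · refine le_trans ?_ ((eLpNorm_restrict_le _ p volume Ω).trans
      (H' i φ (t • y) (hr.2.2 i) (ht3 i)))
    refine le_of_eq (eLpNorm_congr_ae ?_)
    filter_upwards [ae_restrict_mem hm] with x hx
    rw [hv3]
    have hb : ∀ z ∈ tsupport ψ, x + t • y - z ∈ tsupport (φ.normed volume) → z ∈ Ω := by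
      intro z hz hz'
      rw [φ.tsupport_normed_eq] at hz'
      by_contra hzΩ
      refine Set.disjoint_left.1 hdis' ?_
        (Metric.self_subset_cthickening _ ⟨hz, hzΩ⟩)
      refine Metric.mem_cthickening_of_dist_le z (x + t • y) η _ ⟨x, subset_closure hx, rfl⟩ ?_
      have h1 : ‖x + t • y - z‖ ≤ r := by simpa using hz'
      rw [dist_comm, dist_eq_norm]
      linarith [hr.2.1]
    have key := integral_cutoff_mul_fderiv_kernel (hu.integrable hp) ((hg i).integrable hp)
      (hug i) hψ hψ' hρ (x + t • y) hb
    have e1 : ∀ k : Space d → ℝ, ∫ z, F z * k z = ∫ z in Ω, ψ z * u z * k z := by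
      intro k
      rw [← integral_indicator hm]
      congr 1 with z
      by_cases hz : z ∈ Ω <;> simp [hF, hz]
    have e2 : ∀ k : Space d → ℝ, ∫ z, G i z * k z = ∫ z in Ω,
        (ψ z * g i z + fderiv ℝ ψ z (EuclideanSpace.single i 1) * u z) * k z := by
      intro k
      rw [← integral_indicator hm]
      congr 1 with z
      by_cases hz : z ∈ Ω <;> simp [hG, hz]
    rw [e1 fun z => fderiv ℝ (φ.normed volume) (x + t • y - z) (EuclideanSpace.single i 1),
      e2 fun z => φ.normed volume (x + t • y - z), key]
    simp [hG, hx]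

/-- Interior points need no shift. At a boundary point the segment condition requires `z ∈ U`,
whereas only `z + t • y ∈ K` is known; a thickening of the compact set `K` inside `U` bridges the
two for small `t`. Boundedness of `O` will make the cut-offs compactly supported. -/
theorem exists_open_shift {d : ℕ} {Ω : Set (Space d)} (hΩ : IsBoundedDomain Ω)
    (hseg : SegmentCondition Ω) {x : Space d} (hx : x ∈ closure Ω) :
    ∃ O : Set (Space d), IsOpen O ∧ Bornology.IsBounded O ∧ x ∈ O ∧ ∃ y : Space d,
      ∀ K ⊆ O, IsCompact K → ∀ᶠ t in 𝓝[>] (0 : ℝ), ∀ z ∈ closure Ω,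
        z + t • y ∈ K → z + t • y ∈ Ω := by
  by_cases hxΩ : x ∈ Ω
  · exact ⟨Ω, hΩ.1, hΩ.2, hxΩ, 0, fun K hK _ => Eventually.of_forall fun t z _ hz => hK hz⟩
  obtain ⟨U, hU, y, -, hy⟩ := hseg x ⟨hx, by rwa [hΩ.1.interior_eq]⟩
  refine ⟨interior U ∩ Metric.ball x 1, isOpen_interior.inter Metric.isOpen_ball,
    Metric.isBounded_ball.subset Set.inter_subset_right,
    ⟨mem_interior_iff_mem_nhds.2 hU, Metric.mem_ball_self one_pos⟩, y, fun K hK hKc => ?_⟩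
  obtain ⟨η, hη, hsub⟩ := hKc.exists_thickening_subset_open isOpen_interior
    (hK.trans Set.inter_subset_left)
  have hc : Tendsto (fun t : ℝ => ‖t • y‖) (𝓝[>] 0) (𝓝 0) := by
    have : Continuous fun t : ℝ => ‖t • y‖ := by fun_prop
    simpa using (this.tendsto 0).mono_left nhdsWithin_le_nhds
  filter_upwards [hc.eventually (gt_mem_nhds hη), self_mem_nhdsWithin,
    nhdsWithin_le_nhds (gt_mem_nhds one_pos)] with t ht1 ht0 ht z hz hzK
  refine hy z ⟨hz, interior_subset (hsub ?_)⟩ t ht0 ht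
  exact Metric.mem_thickening_iff.2 ⟨_, hzK, by rwa [dist_comm, dist_eq_norm, add_sub_cancel_left]⟩

open scoped Manifold in
theorem exists_smooth_partition {d : ℕ} {Ω : Set (Space d)} (hΩ : IsBoundedDomain Ω)
    (hseg : SegmentCondition Ω) :
    ∃ (ι : Type) (_ : Fintype ι) (ψ : ι → Space d → ℝ), (∀ j, ContDiff ℝ ∞ (ψ j)) ∧
      (∀ j, HasCompactSupport (ψ j)) ∧
      (∀ j, ∃ y : Space d, ∀ᶠ t in 𝓝[>] (0 : ℝ), ∀ z ∈ closure Ω,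
        z + t • y ∈ tsupport (ψ j) → z + t • y ∈ Ω) ∧
      ∀ x ∈ Ω, ∑ j, ψ j x = 1 := by
  choose O hO hOb hxO y hy using fun x : closure Ω => exists_open_shift hΩ hseg x.2
  obtain ⟨t, ht⟩ := hΩ.2.isCompact_closure.elim_finite_subcover O hO
    fun x hx => Set.mem_iUnion.2 ⟨⟨x, hx⟩, hxO _⟩
  obtain ⟨f, hf⟩ := SmoothPartitionOfUnity.exists_isSubordinate 𝓘(ℝ, Space d)
    (isClosed_closure (s := Ω)) (fun j : t => O j) (fun j => hO _) (by
      rwa [Set.iUnion_subtype])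
  have hc : ∀ j, HasCompactSupport (f j) := fun j =>
    Metric.isCompact_of_isClosed_isBounded (isClosed_tsupport _) ((hOb _).subset (hf j))
  refine ⟨t, inferInstance, fun j => f j, fun j => (f j).contMDiff.contDiff, hc,
    fun j => ⟨y j, hy j _ (hf j) (hc j)⟩, fun x hx => ?_⟩
  rw [← finsum_eq_sum_of_fintype]
  exact f.sum_eq_one (subset_closure hx)

/-- Smooth functions are dense in `W^{1,p}(Ω)` if `Ω` satisfies the segment condition. -/
theorem exists_smooth_approx {d : ℕ} {Ω : Set (Space d)} (hΩ : IsBoundedDomain Ω)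
    (hseg : SegmentCondition Ω) {p : ℝ≥0∞} (hp : 1 ≤ p) (hp' : p ≠ ⊤) {u : Space d → ℝ}
    {g : Fin d → Space d → ℝ} (hu : MemLp u p (volume.restrict Ω))
    (hug : ∀ i, HasWeakPartialDeriv Ω i u (g i)) (hg : ∀ i, MemLp (g i) p (volume.restrict Ω))
    {ε : ℝ≥0∞} (hε : ε ≠ 0) :
    ∃ v : Space d → ℝ, ContDiff ℝ ∞ v ∧ HasCompactSupport v ∧
      eLpNorm (fun x => v x - u x) p (volume.restrict Ω) ≤ ε ∧
      ∀ i, eLpNorm (fun x => fderiv ℝ v x (EuclideanSpace.single i 1) - g i x) p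
        (volume.restrict Ω) ≤ ε := by
  obtain ⟨ι, _, ψ, hψ, hψ', hy, hsum⟩ := exists_smooth_partition hΩ hseg
  have hm : MeasurableSet Ω := hΩ.1.measurableSet
  obtain ⟨η, hη0, hη⟩ : ∃ η : ℝ≥0∞, η ≠ 0 ∧ ∑ _j : ι, η ≤ ε := by
    refine ⟨ε / (Fintype.card ι + 1), ?_, ?_⟩
    · exact (ENNReal.div_pos hε (by finiteness)).ne'
    · rw [Finset.sum_const, Finset.card_univ, nsmul_eq_mul]
      calc (Fintype.card ι : ℝ≥0∞) * (ε / (Fintype.card ι + 1))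
          ≤ (Fintype.card ι + 1) * (ε / (Fintype.card ι + 1)) := by gcongr; exact le_self_add
        _ ≤ ε := ENNReal.mul_div_le
  choose y hy using hy
  choose v hv hv' hv1 hv2 using fun j =>
    exists_smooth_approx_cutoff_mul hΩ hp hp' hu hug hg (hψ j) (hψ' j) (hy j) hη0
  have hd : ∀ j, Differentiable ℝ (ψ j) := fun j => (hψ j).differentiable (by simp)
  have hdv : ∀ j, Differentiable ℝ (v j) := fun j => (hv j).differentiable (by simp)
  -- Since the cut-offs sum to 1 on the open set `Ω`, their gradients cancel there, and so do the
  -- terms `u ∂ψ_j` when the pieces are added.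
  have hψ0 : ∀ x ∈ Ω, ∀ e, ∑ j, fderiv ℝ (ψ j) x e = 0 := by
    intro x hx e
    have h1 : (fun z => ∑ j, ψ j z) =ᶠ[𝓝 x] fun _ => 1 := by
      filter_upwards [hΩ.1.mem_nhds hx] with z hz using hsum z hz
    have h2 := h1.fderiv_eq (𝕜 := ℝ)
    rw [fderiv_fun_sum fun j _ => (hd j) x] at h2
    simpa using DFunLike.congr_fun h2 e
  have hucont : ∀ k, Continuous k → ∀ f : Space d → ℝ, MemLp f p (volume.restrict Ω) →
      AEStronglyMeasurable (fun x => k x * f x) (volume.restrict Ω) := fun k hk f hf =>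
    hk.aestronglyMeasurable.mul hf.1
  refine ⟨fun x => ∑ j, v j x, ContDiff.sum fun j _ => hv j, ?_, ?_, fun i => ?_⟩
  · have : HasCompactSupport (∑ j, v j) :=
      Finset.sum_induction _ HasCompactSupport (fun _ _ => HasCompactSupport.add)
        HasCompactSupport.zero fun j _ => hv' j
    convert this using 1
    ext x
    simp
  · have h1 : (fun x => (∑ j, v j x) - u x) =ᵐ[volume.restrict Ω]
        ∑ j, fun x => v j x - ψ j x * u x := by
      filter_upwards [ae_restrict_mem hm] with x hx
      rw [Finset.sum_apply, Finset.sum_sub_distrib, ← Finset.sum_mul, hsum x hx, one_mul]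
    rw [eLpNorm_congr_ae h1]
    refine (eLpNorm_sum_le (fun j _ => ?_) hp).trans ((Finset.sum_le_sum fun j _ => hv1 j).trans hη)
    exact (hv j).continuous.aestronglyMeasurable.sub (hucont _ (hψ j).continuous _ hu)
  · have h1 : (fun x => fderiv ℝ (fun x => ∑ j, v j x) x (EuclideanSpace.single i 1) - g i x)
        =ᵐ[volume.restrict Ω] ∑ j, fun x => fderiv ℝ (v j) x (EuclideanSpace.single i 1) -
          (ψ j x * g i x + fderiv ℝ (ψ j) x (EuclideanSpace.single i 1) * u x) := by
      filter_upwards [ae_restrict_mem hm] with x hx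
      rw [Finset.sum_apply, Finset.sum_sub_distrib, Finset.sum_add_distrib, ← Finset.sum_mul,
        ← Finset.sum_mul, hsum x hx, hψ0 x hx, fderiv_fun_sum fun j _ => (hdv j) x]
      simp
    rw [eLpNorm_congr_ae h1]
    refine (eLpNorm_sum_le (fun j _ => ?_) hp).trans
      ((Finset.sum_le_sum fun j _ => hv2 j i).trans hη)
    have hc : ∀ f : Space d → ℝ, ContDiff ℝ ∞ f →
        Continuous fun x => fderiv ℝ f x (EuclideanSpace.single i 1) := fun f hf =>
      (hf.continuous_fderiv (by simp)).clm_apply continuous_const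
    exact (hc _ (hv j)).aestronglyMeasurable.sub
      ((hucont _ (hψ j).continuous _ (hg i)).add (hucont _ (hc _ (hψ j)) _ hu))

/-! ### Gaussian sums over point sets of bounded density. -/

/-- A Gaussian sum over a point set of bounded density is bounded. -/
theorem exists_sum_exp_neg_norm_sq_le (d : ℕ) (τ : ℝ) {s : ℝ} (hs : 0 < s) :
    ∃ C : ℝ, ∀ (ι : Type) [Fintype ι] (y : ι → Space d),
      (∀ x, (Nat.card {a // y a ∈ Metric.closedBall x 1} : ℝ) ≤ τ) →
        ∑ a, Real.exp (-s * ‖y a‖ ^ 2) ≤ C := by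
  -- Within distance 1 of `y a` one has `‖z‖² ≤ 2‖y a‖² + 2`, so there `F` dominates `exp (-s ‖y
  -- a‖²)`. Integrating over unit balls compares the sum with `∫ F`, each `z` being counted at most
  -- `τ` times.
  set F : Space d → ℝ := fun z => Real.exp s * Real.exp (-(s / 2) * ‖z‖ ^ 2) with hF
  set B : ℝ := volume.real (Metric.closedBall (0 : Space d) 1) with hB
  have hB0 : 0 < B := ENNReal.toReal_pos
    (Metric.measure_closedBall_pos _ _ one_pos).ne' measure_closedBall_lt_top.ne
  have hFi : Integrable F volume := by
    refine Integrable.const_mul ?_ _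
    have h1 := GaussianFourier.integrable_cexp_neg_mul_sq_norm_add (V := Space d)
      (b := ((s / 2 : ℝ) : ℂ)) (by simpa using hs) 0 0
    refine h1.re.congr (Eventually.of_forall fun z => ?_)
    have : (-((s / 2 : ℝ) : ℂ) * (‖z‖ : ℂ) ^ 2) = ((-(s / 2) * ‖z‖ ^ 2 : ℝ) : ℂ) := by
      push_cast; rfl
    simp only [zero_mul, add_zero]
    rw [this, ← Complex.ofReal_exp]
    exact Complex.ofReal_re _
  refine ⟨τ * (∫ z, F z) / B, fun ι _ y hy => ?_⟩
  rw [le_div_iff₀ hB0, Finset.sum_mul]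
  have hterm : ∀ a, Real.exp (-s * ‖y a‖ ^ 2) * B ≤
      ∫ z, (Metric.closedBall (y a) 1).indicator F z := by
    intro a
    rw [integral_indicator Metric.isClosed_closedBall.measurableSet]
    have hBa : volume.real (Metric.closedBall (y a) 1) = B := by
      rw [hB, Measure.real, Measure.real, Measure.addHaar_closedBall_center]
    rw [← hBa, mul_comm, ← smul_eq_mul, ← setIntegral_const]
    refine setIntegral_mono_on (integrableOn_const measure_closedBall_lt_top.ne) hFi.integrableOn
      Metric.isClosed_closedBall.measurableSet fun z hz => ?_
    simp only [hF, ← Real.exp_add]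
    refine Real.exp_le_exp.2 ?_
    have h1 : ‖z‖ ≤ ‖y a‖ + 1 := by
      have : ‖z - y a‖ ≤ 1 := by simpa [dist_eq_norm] using hz
      linarith [norm_le_norm_add_norm_sub' z (y a)]
    have h2 : ‖z‖ ^ 2 ≤ 2 * ‖y a‖ ^ 2 + 2 := by
      nlinarith [norm_nonneg z, norm_nonneg (y a), sq_nonneg (‖y a‖ - 1)]
    nlinarith
  calc ∑ a, Real.exp (-s * ‖y a‖ ^ 2) * B
      ≤ ∑ a, ∫ z, (Metric.closedBall (y a) 1).indicator F z := Finset.sum_le_sum fun a _ => hterm a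
    _ = ∫ z, ∑ a, (Metric.closedBall (y a) 1).indicator F z :=
      (integral_finsetSum _ fun a _ =>
        hFi.indicator Metric.isClosed_closedBall.measurableSet).symm
    _ ≤ ∫ z, τ * F z := by
      refine integral_mono (integrable_finsetSum _ fun a _ =>
        hFi.indicator Metric.isClosed_closedBall.measurableSet) (hFi.const_mul τ) fun z => ?_
      classical
      have h1 : ∑ a, (Metric.closedBall (y a) 1).indicator F z =
          (Nat.card {a // y a ∈ Metric.closedBall z 1} : ℝ) * F z := by
        rw [Nat.card_eq_fintype_card, Fintype.card_subtype, ← nsmul_eq_mul, ← Finset.sum_const,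
          Finset.sum_filter]
        refine Finset.sum_congr rfl fun a _ => ?_
        simp [Set.indicator_apply, dist_comm]
      simp only [h1]
      exact mul_le_mul_of_nonneg_right (hy z) (by positivity)
    _ = τ * ∫ z, F z := integral_const_mul _ _

/-! ### Exponential families and their mean parametrization. -/

/-- The partition function of the exponential family with base weights `c` and points `y`. -/
noncomputable def partitionFn {d : ℕ} {ι : Type} [Fintype ι] (c : ι → ℝ) (y : ι → Space d)
    (μ : Space d) : ℝ :=
  ∑ b, c b * Real.exp (inner ℝ (y b) μ)

/-- The weights of the exponential family with base weights `c` and points `y`. -/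
noncomputable def expWeight {d : ℕ} {ι : Type} [Fintype ι] (c : ι → ℝ) (y : ι → Space d)
    (μ : Space d) (a : ι) : ℝ :=
  c a * Real.exp (inner ℝ (y a) μ) / partitionFn c y μ

theorem hasFDerivAt_exp_inner {d : ℕ} {ι : Type} (c : ι → ℝ) (y : ι → Space d) (a : ι)
    (μ : Space d) :
    HasFDerivAt (fun μ => c a * Real.exp (inner ℝ (y a) μ))
      ((c a * Real.exp (inner ℝ (y a) μ)) • innerSL ℝ (y a)) μ := by
  have h := (((innerSL ℝ (y a)).hasFDerivAt (x := μ)).exp.const_mul (c a))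
  simpa [smul_smul] using h

section ExponentialFamily

variable {d : ℕ} {ι : Type} [Fintype ι] {c : ι → ℝ} {y : ι → Space d}

theorem partitionFn_pos [Nonempty ι] (hc : ∀ a, 0 < c a) (μ : Space d) :
    0 < partitionFn c y μ :=
  Finset.sum_pos (fun a _ => mul_pos (hc a) (Real.exp_pos _)) Finset.univ_nonempty

theorem expWeight_pos [Nonempty ι] (hc : ∀ a, 0 < c a) (μ : Space d) (a : ι) :
    0 < expWeight c y μ a :=
  div_pos (mul_pos (hc a) (Real.exp_pos _)) (partitionFn_pos hc μ)

theorem sum_expWeight [Nonempty ι] (hc : ∀ a, 0 < c a) (μ : Space d) :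
    ∑ a, expWeight c y μ a = 1 := by
  simp only [expWeight]
  rw [← Finset.sum_div]
  exact div_self (partitionFn_pos hc μ).ne'

theorem contDiff_partitionFn : ContDiff ℝ 1 (partitionFn c y) := by
  unfold partitionFn
  exact ContDiff.sum fun b _ =>
    contDiff_const.mul (ContDiff.exp ((innerSL ℝ (y b)).contDiff))

theorem contDiff_expWeight [Nonempty ι] (hc : ∀ a, 0 < c a) (a : ι) :
    ContDiff ℝ 1 fun μ => expWeight c y μ a := by
  unfold expWeight
  exact ContDiff.div (contDiff_const.mul (ContDiff.exp ((innerSL ℝ (y a)).contDiff)))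
    contDiff_partitionFn fun μ => (partitionFn_pos hc μ).ne'

theorem hasFDerivAt_partitionFn (μ : Space d) :
    HasFDerivAt (partitionFn c y)
      (innerSL ℝ (∑ a, (c a * Real.exp (inner ℝ (y a) μ)) • y a)) μ := by
  have h := HasFDerivAt.fun_sum (u := Finset.univ) fun a _ =>
    hasFDerivAt_exp_inner c y a μ
  refine h.congr_fderiv ?_
  simp [map_sum]

theorem sum_expWeight_smul (μ : Space d) :
    ∑ a, expWeight c y μ a • y a =
      (partitionFn c y μ)⁻¹ • ∑ a, (c a * Real.exp (inner ℝ (y a) μ)) • y a := by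
  rw [Finset.smul_sum]
  refine Finset.sum_congr rfl fun a _ => ?_
  rw [smul_smul, expWeight, div_eq_inv_mul]

/-- At a centred parameter the gradient of the partition function vanishes, so only the numerator
contributes. -/
theorem hasFDerivAt_expWeight [Nonempty ι] (hc : ∀ a, 0 < c a) {μ : Space d}
    (hμ : ∑ a, expWeight c y μ a • y a = 0) (a : ι) :
    HasFDerivAt (fun μ => expWeight c y μ a) (expWeight c y μ a • innerSL ℝ (y a)) μ := by
  have hZ := (partitionFn_pos (y := y) hc μ).ne'
  have h0 : ∑ a, (c a * Real.exp (inner ℝ (y a) μ)) • y a = 0 := by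
    rw [sum_expWeight_smul] at hμ
    exact (smul_eq_zero.1 hμ).resolve_left (inv_ne_zero hZ)
  have h1 := hasFDerivAt_partitionFn (c := c) (y := y) μ
  rw [h0, map_zero] at h1
  have h2 := (hasFDerivAt_exp_inner c y a μ).fun_mul
    (((hasDerivAt_inv hZ).comp_hasFDerivAt μ h1))
  refine h2.congr_fderiv ?_
  ext e
  simp [expWeight, div_eq_mul_inv]
  ring

/-- The mean-value parametrization of an exponential family near a centred member. -/
theorem exists_mean_inverse [Nonempty ι] (hc : ∀ a, 0 < c a) {μ₀ : Space d}
    (hμ : ∑ a, expWeight c y μ₀ a • y a = 0)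
    (hpos : ∀ e ≠ 0, 0 < ∑ a, expWeight c y μ₀ a * inner ℝ (y a) e ^ 2) :
    ∃ N : Space d → Space d, N 0 = μ₀ ∧
      (∀ᶠ z in 𝓝 0, ∑ a, expWeight c y (N z) a • y a = z) ∧
      (∀ a, ContDiffAt ℝ 1 (fun z => expWeight c y (N z) a) 0) ∧
      ∀ e, ∃ f, (∑ a, (expWeight c y μ₀ a * inner ℝ (y a) f) • y a = e) ∧
        ∀ a, fderiv ℝ (fun z => expWeight c y (N z) a) 0 e =
          expWeight c y μ₀ a * inner ℝ (y a) f := by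
  set G : Space d → Space d := fun μ => ∑ a, expWeight c y μ a • y a with hG
  have hGc : ContDiff ℝ 1 G := ContDiff.sum fun a _ =>
    (contDiff_expWeight hc a).smul contDiff_const
  -- `J` is the covariance operator, which is the derivative of the mean map `G` at a centred
  -- parameter. Positive definiteness makes it invertible, so `G` has a local inverse; the required
  -- `f` is `J⁻¹ e`.
  set J : Space d →L[ℝ] Space d :=
    ∑ a, (expWeight c y μ₀ a • innerSL ℝ (y a)).smulRight (y a) with hJ
  have hJa : ∀ v, J v = ∑ a, (expWeight c y μ₀ a * inner ℝ (y a) v) • y a := by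
    intro v
    simp [hJ]
  have hGJ : HasFDerivAt G J μ₀ := HasFDerivAt.fun_sum fun a _ =>
    (hasFDerivAt_expWeight hc hμ a).smul_const (y a)
  have hinj : Function.Injective J := by
    rw [injective_iff_map_eq_zero]
    intro e he
    by_contra hne
    have h1 : inner ℝ (J e) e = ∑ a, expWeight c y μ₀ a * inner ℝ (y a) e ^ 2 := by
      rw [hJa, sum_inner]
      refine Finset.sum_congr rfl fun a _ => ?_
      rw [real_inner_smul_left]
      ring
    have h2 := hpos e hne
    rw [← h1, he, inner_zero_left] at h2
    exact lt_irrefl _ h2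
  set J' : Space d ≃L[ℝ] Space d :=
    (LinearEquiv.ofInjectiveEndo (J : Space d →ₗ[ℝ] Space d) hinj).toContinuousLinearEquiv
    with hJ'
  have hJJ : (J' : Space d →L[ℝ] Space d) = J := by
    ext v
    simp [hJ']
  have hGJ' : HasFDerivAt G (J' : Space d →L[ℝ] Space d) μ₀ := by rwa [hJJ]
  have hst : HasStrictFDerivAt G (J' : Space d →L[ℝ] Space d) μ₀ :=
    hGc.contDiffAt.hasStrictFDerivAt' hGJ' one_ne_zero
  have hG0 : G μ₀ = 0 := hμ
  have hN0 : hst.localInverse G J' μ₀ 0 = μ₀ := by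
    rw [← hG0]
    exact hst.localInverse_apply_image
  have hNc : ContDiffAt ℝ 1 (hst.localInverse G J' μ₀) 0 := by
    have := hGc.contDiffAt.to_localInverse (a := μ₀) hGJ' one_ne_zero
    rwa [hG0] at this
  have hNd : HasFDerivAt (hst.localInverse G J' μ₀) (J'.symm : Space d →L[ℝ] Space d) 0 := by
    have := hst.to_localInverse.hasFDerivAt
    rwa [hG0] at this
  refine ⟨hst.localInverse G J' μ₀, hN0, ?_, fun a => ?_, fun e => ⟨J'.symm e, ?_, fun a => ?_⟩⟩
  · have := hst.eventually_right_inverse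
    rwa [hG0] at this
  · exact (contDiff_expWeight hc a).contDiffAt.comp 0 hNc
  · rw [← hJa, ← hJJ]
    simp
  · have h1 : HasFDerivAt (fun μ => expWeight c y μ a) (expWeight c y μ₀ a • innerSL ℝ (y a))
        (hst.localInverse G J' μ₀ 0) := by
      rw [hN0]
      exact hasFDerivAt_expWeight hc hμ a
    have h2 : HasFDerivAt (fun z => expWeight c y (hst.localInverse G J' μ₀ z) a) _ 0 :=
      h1.comp 0 hNd
    rw [h2.fderiv]
    simp

end ExponentialFamily

/-! ### Uniqueness in the entropy problem. -/

/-- Equality case of Gibbs' inequality. -/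
theorem eq_of_sum_mul_log_le {ι : Type} [Fintype ι] {w q : ι → ℝ} (hw : ∀ a, 0 < w a)
    (hq : ∀ a, 0 ≤ q a) (hs : ∑ a, q a = ∑ a, w a)
    (h : ∑ a, q a * Real.log (q a) ≤ ∑ a, q a * Real.log (w a)) : q = w := by
  -- With equal total masses these nonnegative terms sum to the relative entropy of `q` and `w`, and
  -- `klFun` vanishes only at 1.
  have hterm : ∀ a, w a * InformationTheory.klFun (q a / w a) =
      q a * Real.log (q a) - q a * Real.log (w a) + w a - q a := by
    intro a
    have hwa := (hw a).ne'
    rw [InformationTheory.klFun]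
    rcases (hq a).eq_or_lt with h0 | h0
    · simp [← h0]
    · rw [Real.log_div h0.ne' hwa]
      field_simp
  have hnn : ∀ a, 0 ≤ w a * InformationTheory.klFun (q a / w a) := fun a =>
    mul_nonneg (hw a).le (InformationTheory.klFun_nonneg (div_nonneg (hq a) (hw a).le))
  have hsum : ∑ a, w a * InformationTheory.klFun (q a / w a) = 0 := by
    refine le_antisymm ?_ (Finset.sum_nonneg fun a _ => hnn a)
    simp only [hterm, Finset.sum_sub_distrib, Finset.sum_add_distrib]
    linarith
  funext a
  have h1 := (Finset.sum_eq_zero_iff_of_nonneg fun a _ => hnn a).1 hsum a (Finset.mem_univ a)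
  have h2 := (mul_eq_zero.1 h1).resolve_left (hw a).ne'
  rw [InformationTheory.klFun_eq_zero_iff (div_nonneg (hq a) (hw a).le)] at h2
  exact (div_eq_one_iff_eq (hw a).ne').1 h2

/-- A feasible vector of exponential form is the only minimizer of the LME problem. -/
theorem ApproximationScheme.eq_of_isMinOn_objective {d : ℕ} (S : ApproximationScheme d) {β : ℝ}
    (hβ : 0 < β) {x : Space d} {w q : S.Index → ℝ} (hw : w ∈ S.feasible x) (l : Space d) (κ : ℝ)
    (hwe : ∀ a, w a = Real.exp (-β * ‖x - S.node a‖ ^ 2 + inner ℝ (S.node a) l + κ))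
    (hq : q ∈ S.feasible x) (hmin : IsMinOn (S.objective β x) (S.feasible x) q) : q = w := by
  -- Apart from the quadratic cost, `log (w a)` is affine in the node, so the constraints fix its
  -- average. Comparing objectives thus amounts to comparing relative entropies.
  have hlin : ∀ r ∈ S.feasible x, ∑ a, r a * Real.log (w a) =
      -β * ∑ a, r a * ‖x - S.node a‖ ^ 2 + (inner ℝ x l + κ) := by
    intro r hr
    have h1 : inner ℝ x l = ∑ a, r a * inner ℝ (S.node a) l := by
      rw [← hr.2.2, sum_inner]
      simp_rw [real_inner_smul_left]
    have h2 : κ = ∑ a, r a * κ := by rw [← Finset.sum_mul, hr.2.1, one_mul]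
    rw [h1]
    conv_rhs => rw [h2]
    rw [Finset.mul_sum, ← Finset.sum_add_distrib, ← Finset.sum_add_distrib]
    refine Finset.sum_congr rfl fun a _ => ?_
    rw [hwe a, Real.log_exp]
    ring
  refine eq_of_sum_mul_log_le (fun a => hwe a ▸ Real.exp_pos _) hq.1
    (hq.2.1.trans hw.2.1.symm) ?_
  have h1 : S.objective β x q ≤ S.objective β x w := hmin hw
  have h2 := hlin q hq
  have h3 := hlin w hw
  simp only [ApproximationScheme.objective] at h1
  have h4 : β * (∑ a, q a * ‖x - S.node a‖ ^ 2) + ∑ a, q a * Real.log (q a) ≤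
      β * (∑ a, w a * ‖x - S.node a‖ ^ 2) + ∑ a, w a * Real.log (w a) := by
    have := mul_le_mul_of_nonneg_left h1 hβ.le
    rw [mul_add, mul_add, ← mul_assoc, ← mul_assoc, mul_one_div_cancel hβ.ne', one_mul,
      one_mul] at this
    exact this
  linarith

/-! ### Uniform bounds for centred Gaussian families. -/

/-- A node within 1 of the point at distance 2 in the direction of `e` loses at most `‖e‖` of the
inner product `2‖e‖`. This yields both coercivity of the partition function and nondegeneracy of the
covariance. -/
theorem exists_far_in_direction {d : ℕ} {ι : Type} {y : ι → Space d}
    (hS : ∀ z, ‖z‖ ≤ 2 → ∃ a, ‖y a - z‖ ≤ 1) (e : Space d) :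
    ∃ a, ‖y a‖ ≤ 3 ∧ ‖e‖ ≤ inner ℝ (y a) e := by
  by_cases he : e = 0
  · obtain ⟨a, ha⟩ := hS 0 (by simp)
    refine ⟨a, ?_, by simp [he]⟩
    rw [sub_zero] at ha
    linarith
  have hn : ‖e‖ ≠ 0 := norm_ne_zero_iff.2 he
  have hz : ‖(2 / ‖e‖) • e‖ = 2 := by
    rw [norm_smul, Real.norm_of_nonneg (by positivity), div_mul_cancel₀ _ hn]
  obtain ⟨a, ha⟩ := hS ((2 / ‖e‖) • e) hz.le
  refine ⟨a, ?_, ?_⟩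
  · calc ‖y a‖ = ‖(y a - (2 / ‖e‖) • e) + (2 / ‖e‖) • e‖ := by simp
      _ ≤ 3 := (norm_add_le _ _).trans (by linarith)
  · have h1 : inner ℝ (y a) e = inner ℝ (y a - (2 / ‖e‖) • e) e + 2 * ‖e‖ := by
      rw [inner_sub_left, real_inner_smul_left, real_inner_self_eq_norm_sq]
      field_simp
      ring
    have h2 : -‖e‖ ≤ inner ℝ (y a - (2 / ‖e‖) • e) e := by
      have h3 := abs_real_inner_le_norm (y a - (2 / ‖e‖) • e) e
      have h4 : ‖y a - (2 / ‖e‖) • e‖ * ‖e‖ ≤ 1 * ‖e‖ :=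
        mul_le_mul_of_nonneg_right ha (norm_nonneg _)
      linarith [neg_abs_le (inner ℝ (y a - (2 / ‖e‖) • e) e)]
    linarith

/-- Gaussian base weights. -/
noncomputable def gaussWeight {d : ℕ} {ι : Type} (γ : ℝ) (y : ι → Space d) (a : ι) : ℝ :=
  Real.exp (-γ * ‖y a‖ ^ 2)

section Gaussian

variable {d : ℕ} {ι : Type} [Fintype ι] {γ : ℝ} {y : ι → Space d}

theorem exp_norm_le_partitionFn (hγ : 0 < γ) (hS : ∀ z, ‖z‖ ≤ 2 → ∃ a, ‖y a - z‖ ≤ 1)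
    (μ : Space d) : Real.exp (-9 * γ + ‖μ‖) ≤ partitionFn (gaussWeight γ y) y μ := by
  obtain ⟨a, ha, ha'⟩ := exists_far_in_direction hS μ
  calc Real.exp (-9 * γ + ‖μ‖) ≤ gaussWeight γ y a * Real.exp (inner ℝ (y a) μ) := by
        rw [gaussWeight, ← Real.exp_add]
        refine Real.exp_le_exp.2 ?_
        have : ‖y a‖ ^ 2 ≤ 9 := by nlinarith [norm_nonneg (y a)]
        nlinarith
    _ ≤ _ := Finset.single_le_sum
        (f := fun b => gaussWeight γ y b * Real.exp (inner ℝ (y b) μ))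
        (fun b _ => mul_nonneg (Real.exp_pos _).le (Real.exp_pos _).le) (Finset.mem_univ a)

/-- The partition function is continuous and coercive, hence has a minimiser; its gradient there is
the unnormalised mean. Minimality is kept for later comparison with the value at 0. -/
theorem exists_centred_parameter (hγ : 0 < γ) (hS : ∀ z, ‖z‖ ≤ 2 → ∃ a, ‖y a - z‖ ≤ 1) :
    ∃ μ₀ : Space d, ∑ a, expWeight (gaussWeight γ y) y μ₀ a • y a = 0 ∧
      ∀ μ, partitionFn (gaussWeight γ y) y μ₀ ≤ partitionFn (gaussWeight γ y) y μ := by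
  have hco : Tendsto (partitionFn (gaussWeight γ y) y) (cocompact (Space d)) atTop :=
    tendsto_atTop_mono (exp_norm_le_partitionFn hγ hS)
      (Real.tendsto_exp_atTop.comp (tendsto_atTop_add_const_left _ _
        (tendsto_norm_cocompact_atTop)))
  obtain ⟨μ₀, hμ₀⟩ := contDiff_partitionFn.continuous.exists_forall_le hco
  refine ⟨μ₀, ?_, hμ₀⟩
  have hmin : IsLocalMin (partitionFn (gaussWeight γ y) y) μ₀ := Eventually.of_forall hμ₀
  have h1 := hmin.hasFDerivAt_eq_zero (hasFDerivAt_partitionFn μ₀)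
  rw [sum_expWeight_smul]
  have h2 : ‖innerSL ℝ (∑ a, (gaussWeight γ y a * Real.exp (inner ℝ (y a) μ₀)) • y a)‖ = 0 := by
    rw [h1, norm_zero]
  rw [innerSL_apply_norm, norm_eq_zero] at h2
  rw [h2, smul_zero]

end Gaussian

/-- Use `r³ ≤ 6 eʳ` and complete the square, keeping half of the Gaussian decay. The third moment is
thereby reduced to a Gaussian sum. -/
theorem pow_three_mul_exp_le {γ : ℝ} (hγ : 0 < γ) {r l : ℝ} (hr : 0 ≤ r) :
    r ^ 3 * Real.exp (-γ * r ^ 2 + l * r) ≤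
      6 * Real.exp ((l + 1) ^ 2 / (2 * γ)) * Real.exp (-(γ / 2) * r ^ 2) := by
  have h1 : r ^ 3 ≤ 6 * Real.exp r := by
    have := Real.pow_div_factorial_le_exp r hr 3
    norm_num [Nat.factorial] at this
    linarith
  have h2 : r + (-γ * r ^ 2 + l * r) ≤ (l + 1) ^ 2 / (2 * γ) + -(γ / 2) * r ^ 2 := by
    have h3 : (l + 1) ^ 2 / (2 * γ) + -(γ / 2) * r ^ 2 - (r + (-γ * r ^ 2 + l * r)) =
        (l + 1 - γ * r) ^ 2 / (2 * γ) := by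
      field_simp
      ring
    have h4 : 0 ≤ (l + 1 - γ * r) ^ 2 / (2 * γ) := by positivity
    linarith
  calc r ^ 3 * Real.exp (-γ * r ^ 2 + l * r)
      ≤ 6 * Real.exp r * Real.exp (-γ * r ^ 2 + l * r) := by gcongr
    _ = 6 * Real.exp (r + (-γ * r ^ 2 + l * r)) := by rw [Real.exp_add r, mul_assoc]
    _ ≤ 6 * Real.exp ((l + 1) ^ 2 / (2 * γ) + -(γ / 2) * r ^ 2) := by gcongr
    _ = _ := by rw [Real.exp_add]; ring

/-- The centred member of the Gaussian exponential family of a point set of bounded density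
has bounded third moment and nondegenerate covariance. -/
theorem exists_centred_parameter_bounds (d : ℕ) {γ : ℝ} (hγ : 0 < γ) (τ : ℝ) :
    ∃ K > 0, ∀ (ι : Type) [Fintype ι] (y : ι → Space d),
      (∀ x, (Nat.card {a // y a ∈ Metric.closedBall x 1} : ℝ) ≤ τ) →
      (∀ z, ‖z‖ ≤ 2 → ∃ a, ‖y a - z‖ ≤ 1) →
      ∃ μ₀ : Space d, ∑ a, expWeight (gaussWeight γ y) y μ₀ a • y a = 0 ∧
        ∑ a, expWeight (gaussWeight γ y) y μ₀ a * ‖y a‖ ^ 3 ≤ K ∧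
        ∀ e, ‖e‖ ^ 2 ≤ K * ∑ a, expWeight (gaussWeight γ y) y μ₀ a * inner ℝ (y a) e ^ 2 := by
  obtain ⟨C₁, hC₁⟩ := exists_sum_exp_neg_norm_sq_le d τ hγ
  obtain ⟨C₂, hC₂⟩ := exists_sum_exp_neg_norm_sq_le d τ (half_pos hγ)
  -- `l` bounds `‖μ₀‖`, because `exp (-9γ + ‖μ₀‖) ≤ Z(μ₀) ≤ Z(0) ≤ C₁` for the partition function
  -- `Z`.
  set l : ℝ := 9 * γ + Real.log C₁ with hl
  set M : ℝ := Real.exp (9 * γ) * (6 * Real.exp ((l + 1) ^ 2 / (2 * γ)) * C₂) with hM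
  -- The signs of `C₁` and `C₂` are unknown before a point set is given; the entry 1 ensures
  -- positivity.
  refine ⟨max (max M (C₁ * Real.exp (9 * γ + 3 * l))) 1, by positivity,
    fun ι _ y hy hS => ?_⟩
  obtain ⟨μ₀, hμ₀, hmin⟩ := exists_centred_parameter hγ hS
  obtain ⟨a₀, -⟩ := hS 0 (by simp)
  have : Nonempty ι := ⟨a₀⟩
  have hc : ∀ a, 0 < gaussWeight γ y a := fun a => Real.exp_pos _
  have hZ := partitionFn_pos (y := y) hc μ₀
  have hZu : partitionFn (gaussWeight γ y) y μ₀ ≤ C₁ := by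
    refine (hmin 0).trans (le_trans (le_of_eq ?_) (hC₁ ι y hy))
    simp [partitionFn, gaussWeight]
  have hC₁0 : 0 < C₁ := hZ.trans_le hZu
  have hlow := exp_norm_le_partitionFn hγ hS μ₀
  have hμl : ‖μ₀‖ ≤ l := by
    have h1 := (Real.le_log_iff_exp_le hC₁0).2 (hlow.trans hZu)
    linarith
  have hZl : Real.exp (-9 * γ) ≤ partitionFn (gaussWeight γ y) y μ₀ :=
    (Real.exp_le_exp.2 (by linarith [norm_nonneg μ₀])).trans hlow
  have hw : ∀ a, expWeight (gaussWeight γ y) y μ₀ a =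
      Real.exp (-γ * ‖y a‖ ^ 2 + inner ℝ (y a) μ₀) / partitionFn (gaussWeight γ y) y μ₀ := by
    intro a
    rw [expWeight, gaussWeight, ← Real.exp_add]
  have hin : ∀ a, |inner ℝ (y a) μ₀| ≤ l * ‖y a‖ := fun a => by
    refine (abs_real_inner_le_norm _ _).trans ?_
    rw [mul_comm]
    gcongr
  refine ⟨μ₀, hμ₀, ?_, fun e => ?_⟩
  · refine le_trans ?_ ((le_max_left _ _).trans (le_max_left _ _))
    calc ∑ a, expWeight (gaussWeight γ y) y μ₀ a * ‖y a‖ ^ 3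
        ≤ ∑ a, Real.exp (9 * γ) * (6 * Real.exp ((l + 1) ^ 2 / (2 * γ)) *
          Real.exp (-(γ / 2) * ‖y a‖ ^ 2)) := by
          refine Finset.sum_le_sum fun a _ => ?_
          have h1 : expWeight (gaussWeight γ y) y μ₀ a ≤
              Real.exp (9 * γ) * Real.exp (-γ * ‖y a‖ ^ 2 + l * ‖y a‖) := by
            rw [hw, div_le_iff₀ hZ]
            have h2 : Real.exp (-γ * ‖y a‖ ^ 2 + inner ℝ (y a) μ₀) ≤
                Real.exp (-γ * ‖y a‖ ^ 2 + l * ‖y a‖) :=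
              Real.exp_le_exp.2 (by linarith [(abs_le.1 (hin a)).2])
            have h3 : Real.exp (9 * γ) * Real.exp (-9 * γ) = 1 := by
              rw [← Real.exp_add]; simp
            calc _ ≤ Real.exp (-γ * ‖y a‖ ^ 2 + l * ‖y a‖) := h2
              _ = Real.exp (9 * γ) * Real.exp (-γ * ‖y a‖ ^ 2 + l * ‖y a‖) *
                  Real.exp (-9 * γ) := by rw [mul_right_comm, h3, one_mul]
              _ ≤ _ := by gcongr
          calc _ ≤ Real.exp (9 * γ) * Real.exp (-γ * ‖y a‖ ^ 2 + l * ‖y a‖) * ‖y a‖ ^ 3 := by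
                gcongr
            _ = Real.exp (9 * γ) * (‖y a‖ ^ 3 * Real.exp (-γ * ‖y a‖ ^ 2 + l * ‖y a‖)) := by ring
            _ ≤ _ := mul_le_mul_of_nonneg_left (pow_three_mul_exp_le hγ (norm_nonneg (y a)))
                (Real.exp_pos _).le
      _ = Real.exp (9 * γ) * (6 * Real.exp ((l + 1) ^ 2 / (2 * γ)) *
          ∑ a, Real.exp (-(γ / 2) * ‖y a‖ ^ 2)) := by
          rw [← Finset.mul_sum, ← Finset.mul_sum]
      _ ≤ M := by
          rw [hM]
          gcongr
          exact hC₂ ι y hy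
  -- A single node far in the direction of `e` suffices: its weight is bounded below because `‖y a‖
  -- ≤ 3`, `‖μ₀‖ ≤ l` and the partition function is at most `C₁`.
  · obtain ⟨a, ha, hae⟩ := exists_far_in_direction hS e
    have hl0 : 0 ≤ l := (norm_nonneg _).trans hμl
    have h1 : Real.exp (-(9 * γ + 3 * l)) / C₁ ≤ expWeight (gaussWeight γ y) y μ₀ a := by
      rw [hw]
      refine div_le_div₀ (Real.exp_pos _).le (Real.exp_le_exp.2 ?_) hZ hZu
      have h2 : l * ‖y a‖ ≤ l * 3 := by gcongr
      have h3 : ‖y a‖ ^ 2 ≤ 9 := by nlinarith [norm_nonneg (y a)]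
      nlinarith [(abs_le.1 (hin a)).1]
    have h2 : Real.exp (-(9 * γ + 3 * l)) / C₁ * ‖e‖ ^ 2 ≤
        ∑ a, expWeight (gaussWeight γ y) y μ₀ a * inner ℝ (y a) e ^ 2 := by
      calc _ ≤ expWeight (gaussWeight γ y) y μ₀ a * inner ℝ (y a) e ^ 2 := by
            have := (expWeight_pos (y := y) hc μ₀ a).le
            gcongr
        _ ≤ _ := Finset.single_le_sum
          (f := fun a => expWeight (gaussWeight γ y) y μ₀ a * inner ℝ (y a) e ^ 2)
          (fun b _ => mul_nonneg (expWeight_pos hc _ _).le (sq_nonneg _)) (Finset.mem_univ a)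
    have h3 : ‖e‖ ^ 2 = C₁ * Real.exp (9 * γ + 3 * l) *
        (Real.exp (-(9 * γ + 3 * l)) / C₁ * ‖e‖ ^ 2) := by
      rw [Real.exp_neg]
      field_simp
    rw [h3]
    have h4 : C₁ * Real.exp (9 * γ + 3 * l) ≤ max (max M (C₁ * Real.exp (9 * γ + 3 * l))) 1 :=
      (le_max_right _ _).trans (le_max_left _ _)
    gcongr

/-! ### Regularity of the LME shape functions. -/

theorem dist_lt_of_size_lt {d : ℕ} {A : Set (Space d)} (hA : Bornology.IsBounded A) {h : ℝ}
    (hs : size A < h) {x z : Space d} (hx : x ∈ A) (hz : z ∈ A) : dist x z < h := by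
  obtain ⟨R, hR⟩ := hA.subset_closedBall (0 : Space d)
  have hne : {r : ℝ | 0 ≤ r ∧ ∃ c : Space d, A ⊆ Metric.closedBall c r}.Nonempty :=
    ⟨max R 0, le_max_right _ _, 0, hR.trans (Metric.closedBall_subset_closedBall (le_max_left _ _))⟩
  have h1 : sInf {r : ℝ | 0 ≤ r ∧ ∃ c : Space d, A ⊆ Metric.closedBall c r} < h / 2 := by
    unfold size at hs
    linarith
  obtain ⟨r, ⟨-, c, hc⟩, hr⟩ := exists_lt_of_csInf_lt hne h1
  have h2 := Metric.mem_closedBall.1 (hc hx)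
  have h3 := Metric.mem_closedBall'.1 (hc hz)
  linarith [dist_triangle x c z]

/-- In a covering every point is close to a node. -/
theorem IsCovering.exists_dist_lt {d : ℕ} {h : ℝ} {P A : Set (Space d)} (hc : IsCovering h P A)
    {x : Space d} (hx : x ∈ A) : ∃ z ∈ P, dist z x < h := by
  obtain ⟨v, -, hv, hs, hxv⟩ := hc x hx
  exact ⟨v 0, hv 0, dist_lt_of_size_lt
    (isBounded_convexHull.2 (Set.finite_range v).isBounded) hs
    (subset_convexHull ℝ _ (Set.mem_range_self 0)) hxv⟩

/-- Smoothness and bounds of the LME shape functions at a point whose distance to the complement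
of the domain is at least `2 h`. -/
theorem exists_shape_bounds (d : ℕ) {γ : ℝ} (hγ : 0 < γ) (τ : ℝ) :
    ∃ K > 0, ∀ (S : ApproximationScheme d) (h : ℝ) (Ω' : Set (Space d)) (x₀ : Space d), 0 < h →
      Metric.closedBall x₀ (2 * h) ⊆ Ω' → S.IsLME (γ / h ^ 2) Ω' → IsCovering h S.points Ω' →
      S.HasDensityBound h τ →
      (∀ a, ContDiffAt ℝ 1 (S.shape a) x₀) ∧
      ∑ a, S.shape a x₀ * ‖S.node a - x₀‖ ^ 3 ≤ K * h ^ 3 ∧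
      ∀ e, ∃ f, ‖f‖ ≤ K * ‖e‖ ∧
        ∑ a, (S.shape a x₀ * inner ℝ (S.node a - x₀) f) • (S.node a - x₀) = h ^ 2 • e ∧
        ∀ a, fderiv ℝ (S.shape a) x₀ e =
          (h ^ 2)⁻¹ * (S.shape a x₀ * inner ℝ (S.node a - x₀) f) := by
  obtain ⟨K, hK, H⟩ := exists_centred_parameter_bounds d hγ τ
  refine ⟨K, hK, fun S h Ω' x₀ hh hball hLME hcov hdens => ?_⟩
  -- Rescaling about `x₀` turns the parameter `γ / h²` into `γ` and the radius `h` into 1, so the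
  -- bounds become independent of `h`.
  set y : S.Index → Space d := fun a => h⁻¹ • (S.node a - x₀) with hy
  have hnode : ∀ a, S.node a - x₀ = h • y a := fun a => by
    rw [hy, smul_inv_smul₀ hh.ne']
  clear_value y
  have hD : ∀ x, (Nat.card {a // y a ∈ Metric.closedBall x 1} : ℝ) ≤ τ := by
    intro x
    have h1 : ∀ a, y a ∈ Metric.closedBall x 1 ↔
        S.node a ∈ Metric.closedBall (x₀ + h • x) h := by
      intro a
      have h2 : S.node a - (x₀ + h • x) = h • (y a - x) := by
        rw [smul_sub, ← hnode]
        abel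
      rw [Metric.mem_closedBall, Metric.mem_closedBall, dist_eq_norm, dist_eq_norm, h2, norm_smul,
        Real.norm_of_nonneg hh.le, mul_le_iff_le_one_right hh]
    rw [Nat.card_congr (Equiv.subtypeEquivRight h1)]
    exact hdens _
  have hS : ∀ z, ‖z‖ ≤ 2 → ∃ a, ‖y a - z‖ ≤ 1 := by
    intro z hz
    have hmem : x₀ + h • z ∈ Ω' := by
      refine hball ?_
      rw [Metric.mem_closedBall, dist_eq_norm, add_sub_cancel_left, norm_smul,
        Real.norm_of_nonneg hh.le, mul_comm]
      gcongr
    obtain ⟨_, ⟨a, rfl⟩, ha⟩ := hcov.exists_dist_lt hmem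
    refine ⟨a, ?_⟩
    have h1 : S.node a - (x₀ + h • z) = h • (y a - z) := by
      rw [smul_sub, ← hnode]
      abel
    rw [dist_eq_norm, h1, norm_smul, Real.norm_of_nonneg hh.le] at ha
    by_contra hcon
    push Not at hcon
    nlinarith
  obtain ⟨μ₀, hμ₀, hK3, hcovar⟩ := H S.Index y hD hS
  obtain ⟨a₀, -⟩ := hS 0 (by simp)
  have : Nonempty S.Index := ⟨a₀⟩
  have hc : ∀ a, 0 < gaussWeight γ y a := fun a => Real.exp_pos _
  have hpos : ∀ e ≠ 0, 0 < ∑ a, expWeight (gaussWeight γ y) y μ₀ a * inner ℝ (y a) e ^ 2 := by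
    intro e he
    have h1 := hcovar e
    have h2 : 0 < ‖e‖ ^ 2 := by positivity
    exact (pos_iff_pos_of_mul_pos (h2.trans_le h1)).1 hK
  obtain ⟨N, hN0, hN, hNc, hNd⟩ := exists_mean_inverse hc hμ₀ hpos
  -- The member of the family with mean `(x - x₀) / h` is feasible at `x` and has exponential form,
  -- so it is the unique minimizer.
  have hev : ∀ᶠ x in 𝓝 x₀, ∀ a, S.shape a x =
      expWeight (gaussWeight γ y) y (N (h⁻¹ • (x - x₀))) a := by
    have hmap : Tendsto (fun x : Space d => h⁻¹ • (x - x₀)) (𝓝 x₀) (𝓝 0) := by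
      have : Continuous fun x : Space d => h⁻¹ • (x - x₀) := by fun_prop
      simpa using this.tendsto x₀
    filter_upwards [hmap.eventually hN, Filter.mem_of_superset
      (Metric.closedBall_mem_nhds x₀ (by positivity)) hball] with x hx hxΩ
    set z := h⁻¹ • (x - x₀) with hz
    have hxz : x - x₀ = h • z := by rw [hz, smul_inv_smul₀ hh.ne']
    set w := expWeight (gaussWeight γ y) y (N z) with hw
    have hwpos : ∀ a, 0 < w a := fun a => expWeight_pos hc _ a
    have hw1 : ∑ a, w a = 1 := sum_expWeight hc _
    have hfeas : w ∈ S.feasible x := by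
      refine ⟨fun a => (hwpos a).le, hw1, ?_⟩
      have h1 : ∑ a, w a • S.node a = ∑ a, w a • (x₀ + h • y a) :=
        Finset.sum_congr rfl fun a _ => by rw [← hnode, add_sub_cancel]
      rw [h1]
      simp only [smul_add, Finset.sum_add_distrib]
      rw [← Finset.sum_smul, hw1, one_smul]
      simp only [smul_comm _ h]
      rw [← Finset.smul_sum, hx, ← hxz, add_sub_cancel]
    have hq := hLME x hxΩ
    -- Expanding `-γ ‖z - y a‖²` produces the cross term `2γ ⟨y a, z⟩`, removed by the shift `-2γ z`
    -- of the multiplier. The constant absorbs `γ ‖z‖²`, the origin `x₀` and the normalisation.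
    have key := S.eq_of_isMinOn_objective (β := γ / h ^ 2) (by positivity) hfeas
      (h⁻¹ • (N z - (2 * γ) • z))
      (γ * ‖z‖ ^ 2 - inner ℝ x₀ (h⁻¹ • (N z - (2 * γ) • z)) -
        Real.log (partitionFn (gaussWeight γ y) y (N z)))
      (fun a => ?_) hq.1 hq.2
    · exact fun a => congrFun key a
    · have e1 : x - S.node a = h • (z - y a) := by
        rw [smul_sub, ← hnode, ← hxz]
        abel
      have e2 : γ / h ^ 2 * ‖x - S.node a‖ ^ 2 = γ * ‖z - y a‖ ^ 2 := by
        rw [e1, norm_smul, Real.norm_of_nonneg hh.le, mul_pow]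
        field_simp
      have e3 : inner ℝ (S.node a) (h⁻¹ • (N z - (2 * γ) • z)) =
          inner ℝ x₀ (h⁻¹ • (N z - (2 * γ) • z)) + inner ℝ (y a) (N z - (2 * γ) • z) := by
        rw [← sub_eq_iff_eq_add', ← inner_sub_left, hnode, real_inner_smul_left,
          real_inner_smul_right, mul_inv_cancel_left₀ hh.ne']
      have e4 : -(γ / h ^ 2) * ‖x - S.node a‖ ^ 2 +
          inner ℝ (S.node a) (h⁻¹ • (N z - (2 * γ) • z)) +
          (γ * ‖z‖ ^ 2 - inner ℝ x₀ (h⁻¹ • (N z - (2 * γ) • z)) -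
            Real.log (partitionFn (gaussWeight γ y) y (N z))) =
          -γ * ‖y a‖ ^ 2 + inner ℝ (y a) (N z) -
            Real.log (partitionFn (gaussWeight γ y) y (N z)) := by
        rw [neg_mul, e2, e3, norm_sub_sq_real, inner_sub_right,
          real_inner_smul_right (y a) z, real_inner_comm z (y a)]
        ring
      rw [e4, Real.exp_sub, Real.exp_log (partitionFn_pos hc _), Real.exp_add]
      rfl
  have hw0 : ∀ a, S.shape a x₀ = expWeight (gaussWeight γ y) y μ₀ a := by
    intro a
    rw [hev.self_of_nhds a, sub_self, smul_zero, hN0]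
  have heva : ∀ a, S.shape a =ᶠ[𝓝 x₀] fun x =>
      expWeight (gaussWeight γ y) y (N (h⁻¹ • (x - x₀))) a := fun a => hev.mono fun x hx => hx a
  have hin0 : h⁻¹ • (x₀ - x₀) = 0 := by simp
  refine ⟨fun a => ?_, ?_, fun e => ?_⟩
  · refine ContDiffAt.congr_of_eventuallyEq ?_ (heva a)
    have h1 : ContDiffAt ℝ 1 (fun z => expWeight (gaussWeight γ y) y (N z) a)
        (h⁻¹ • (x₀ - x₀)) := by
      rw [hin0]
      exact hNc a
    exact h1.comp x₀ (f := fun x => h⁻¹ • (x - x₀)) (by fun_prop)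
  · have h1 : ∀ a, S.shape a x₀ * ‖S.node a - x₀‖ ^ 3 =
        expWeight (gaussWeight γ y) y μ₀ a * ‖y a‖ ^ 3 * h ^ 3 := by
      intro a
      rw [hw0, hnode, norm_smul, Real.norm_of_nonneg hh.le]
      ring
    simp only [h1]
    rw [← Finset.sum_mul]
    gcongr
  · obtain ⟨f, hf, hfd⟩ := hNd (h⁻¹ • e)
    refine ⟨h • f, ?_, ?_, fun a => ?_⟩
    -- Pairing `J f = h⁻¹ e` with `f` gives the covariance form, whose lower bound yields `‖h f‖ ≤ K
    -- ‖e‖`.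
    · have h1 : inner ℝ (h⁻¹ • e) f =
          ∑ a, expWeight (gaussWeight γ y) y μ₀ a * inner ℝ (y a) f ^ 2 := by
        rw [← hf, sum_inner]
        refine Finset.sum_congr rfl fun a _ => ?_
        rw [real_inner_smul_left]
        ring
      have h2 := hcovar f
      rw [← h1, real_inner_smul_left] at h2
      have h3 : h * ‖f‖ ^ 2 ≤ K * ‖e‖ * ‖f‖ := by
        calc h * ‖f‖ ^ 2 ≤ h * (K * (h⁻¹ * inner ℝ e f)) := by gcongr
          _ = K * inner ℝ e f := by field_simp
          _ ≤ K * (‖e‖ * ‖f‖) := by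
            gcongr
            exact real_inner_le_norm e f
          _ = _ := by ring
      rw [norm_smul, Real.norm_of_nonneg hh.le]
      rcases (norm_nonneg f).eq_or_lt with h0 | h0
      · rw [← h0, mul_zero]
        positivity
      · refine le_of_mul_le_mul_right ?_ h0
        linarith
    · have h1 : ∀ a, (S.shape a x₀ * inner ℝ (S.node a - x₀) (h • f)) • (S.node a - x₀) =
          h ^ 3 • ((expWeight (gaussWeight γ y) y μ₀ a * inner ℝ (y a) f) • y a) := by
        intro a
        rw [hw0, hnode, real_inner_smul_left, real_inner_smul_right, smul_smul, smul_smul]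
        congr 1
        ring
      simp only [h1]
      rw [← Finset.smul_sum, hf, smul_smul]
      congr 1
      field_simp
    · rw [(heva a).fderiv_eq]
      have h1 : HasFDerivAt (fun z => expWeight (gaussWeight γ y) y (N z) a)
          (fderiv ℝ (fun z => expWeight (gaussWeight γ y) y (N z) a) 0) (h⁻¹ • (x₀ - x₀)) := by
        rw [hin0]
        exact ((hNc a).differentiableAt one_ne_zero).hasFDerivAt
      have h2 : HasFDerivAt (fun x : Space d => h⁻¹ • (x - x₀))
          (h⁻¹ • ContinuousLinearMap.id ℝ (Space d)) x₀ :=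
        ((hasFDerivAt_id x₀).sub_const x₀).const_smul h⁻¹
      have h3 : HasFDerivAt
          (fun x => expWeight (gaussWeight γ y) y (N (h⁻¹ • (x - x₀))) a) _ x₀ :=
        HasFDerivAt.comp (g := fun z => expWeight (gaussWeight γ y) y (N z) a) x₀ h1 h2
      rw [h3.fderiv]
      have h4 : (fderiv ℝ (fun z => expWeight (gaussWeight γ y) y (N z) a) 0) (h⁻¹ • e) =
        _ := hfd a
      rw [ContinuousLinearMap.comp_apply, smul_apply,
        ContinuousLinearMap.id_apply, h4, hw0, hnode, real_inner_smul_left, real_inner_smul_right]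
      field_simp

/-! ### Interpolation error for smooth functions. -/

/-- Compact support makes `v` and its derivative globally Lipschitz; the quadratic bound is the mean
value inequality on the ball of radius `‖z - x‖` about `x`. -/
theorem exists_taylor_bounds {d : ℕ} {v : Space d → ℝ} (hv : ContDiff ℝ ∞ v)
    (hv' : HasCompactSupport v) :
    ∃ M : ℝ, 0 ≤ M ∧ (∀ x z, |v z - v x| ≤ M * ‖z - x‖) ∧
      ∀ x z, |v z - v x - fderiv ℝ v x (z - x)| ≤ M * ‖z - x‖ ^ 2 := by
  obtain ⟨C₁, hC₁⟩ := hv.lipschitzWith_of_hasCompactSupport hv' (by simp)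
  obtain ⟨C₂, hC₂⟩ := (hv.fderiv_right (m := ∞) le_rfl).lipschitzWith_of_hasCompactSupport
    (hv'.fderiv ℝ) (by simp)
  refine ⟨max C₁ C₂, C₁.2.trans (le_max_left _ _), fun x z => ?_, fun x z => ?_⟩
  · have h1 := hC₁.norm_sub_le z x
    rw [Real.norm_eq_abs] at h1
    exact h1.trans (by gcongr; exact le_max_left _ _)
  · have h1 : ‖v z - v x - fderiv ℝ v x (z - x)‖ ≤ C₂ * ‖z - x‖ * ‖z - x‖ := by
      refine (convex_closedBall x ‖z - x‖).norm_image_sub_le_of_norm_fderiv_le' (𝕜 := ℝ)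
        (fun w _ => hv.differentiable (by simp) w) (fun w hw => ?_)
        (Metric.mem_closedBall_self (norm_nonneg _)) (by simp [dist_eq_norm])
      refine (hC₂.norm_sub_le w x).trans ?_
      gcongr
      simpa [dist_eq_norm] using hw
    rw [Real.norm_eq_abs] at h1
    calc _ ≤ C₂ * ‖z - x‖ * ‖z - x‖ := h1
      _ = C₂ * ‖z - x‖ ^ 2 := by ring
      _ ≤ _ := by gcongr; exact le_max_right _ _

/-- The interpolant of `v` with the shape functions. -/
noncomputable def ApproximationScheme.interpolant {d : ℕ} (S : ApproximationScheme d)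
    (v : Space d → ℝ) (x : Space d) : ℝ :=
  ∑ a, v (S.node a) * S.shape a x

theorem ApproximationScheme.interpolant_mem_space {d : ℕ} (S : ApproximationScheme d)
    (v : Space d → ℝ) : S.interpolant v ∈ S.space := by
  have h1 : S.interpolant v = ∑ a, v (S.node a) • S.shape a := by
    ext x
    simp [ApproximationScheme.interpolant]
  rw [h1]
  exact Submodule.sum_mem _ fun a _ =>
    Submodule.smul_mem _ _ (Submodule.subset_span (Set.mem_range_self a))

/-- First order error bounds for the interpolant of a smooth function. -/
theorem exists_interpolant_bounds {d : ℕ} {γ : ℝ} (hγ : 0 < γ) (τ : ℝ) {v : Space d → ℝ}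
    (hv : ContDiff ℝ ∞ v) (hv' : HasCompactSupport v) :
    ∃ C : ℝ, ∀ (S : ApproximationScheme d) (h : ℝ) (Ω' : Set (Space d)) (x₀ : Space d), 0 < h →
      Metric.closedBall x₀ (2 * h) ⊆ Ω' → S.IsLME (γ / h ^ 2) Ω' → IsCovering h S.points Ω' →
      S.HasDensityBound h τ →
      ContDiffAt ℝ 1 (S.interpolant v) x₀ ∧ |S.interpolant v x₀ - v x₀| ≤ C * h ∧
        ∀ e, |fderiv ℝ (S.interpolant v) x₀ e - fderiv ℝ v x₀ e| ≤ C * h * ‖e‖ := by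
  obtain ⟨K, hK, H⟩ := exists_shape_bounds d hγ τ
  obtain ⟨M, hM, hM1, hM2⟩ := exists_taylor_bounds hv hv'
  refine ⟨max (M * (1 + K)) (M * K * K), fun S h Ω' x₀ hh hball hLME hcov hdens => ?_⟩
  obtain ⟨hc, hK3, hder⟩ := H S h Ω' x₀ hh hball hLME hcov hdens
  obtain ⟨hw0, hw1, hwx⟩ := (hLME x₀ (hball (Metric.mem_closedBall_self (by positivity)))).1
  have hcI : ContDiffAt ℝ 1 (S.interpolant v) x₀ :=
    ContDiffAt.sum fun a _ => contDiffAt_const.mul (hc a)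
  refine ⟨hcI, ?_, fun e => ?_⟩
  · have e1 : S.interpolant v x₀ - v x₀ = ∑ a, S.shape a x₀ * (v (S.node a) - v x₀) := by
      simp only [mul_sub, Finset.sum_sub_distrib, ← Finset.sum_mul, hw1, one_mul,
        ApproximationScheme.interpolant, mul_comm (v _)]
    -- Splitting at `h` controls the first moment by the total mass and the third moment.
    have e2 : ∀ a, ‖S.node a - x₀‖ ≤ h + (h ^ 2)⁻¹ * ‖S.node a - x₀‖ ^ 3 := by
      intro a
      set t := ‖S.node a - x₀‖
      have ht : 0 ≤ t := norm_nonneg _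
      rcases le_total t h with h1 | h1
      · exact h1.trans (le_add_of_nonneg_right (by positivity))
      · have h2 : h ^ 2 * t ≤ t ^ 3 := by
          calc h ^ 2 * t ≤ t ^ 2 * t := by gcongr
            _ = t ^ 3 := by ring
        have h3 : t ≤ (h ^ 2)⁻¹ * t ^ 3 := by
          rw [le_inv_mul_iff₀ (by positivity)]
          exact h2
        linarith
    calc |S.interpolant v x₀ - v x₀|
        ≤ ∑ a, S.shape a x₀ * (M * (h + (h ^ 2)⁻¹ * ‖S.node a - x₀‖ ^ 3)) := by
          rw [e1]
          refine (Finset.abs_sum_le_sum_abs _ _).trans (Finset.sum_le_sum fun a _ => ?_)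
          rw [abs_mul, abs_of_nonneg (hw0 a)]
          refine mul_le_mul_of_nonneg_left ((hM1 _ _).trans ?_) (hw0 a)
          exact mul_le_mul_of_nonneg_left (e2 a) hM
      _ = M * (h + (h ^ 2)⁻¹ * ∑ a, S.shape a x₀ * ‖S.node a - x₀‖ ^ 3) := by
          have h1 : ∀ a, S.shape a x₀ * (M * (h + (h ^ 2)⁻¹ * ‖S.node a - x₀‖ ^ 3)) =
              S.shape a x₀ * (M * h) +
                M * (h ^ 2)⁻¹ * (S.shape a x₀ * ‖S.node a - x₀‖ ^ 3) := fun a => by ring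
          simp only [h1]
          rw [Finset.sum_add_distrib, ← Finset.sum_mul, hw1, ← Finset.mul_sum]
          ring
      _ ≤ M * (h + (h ^ 2)⁻¹ * (K * h ^ 3)) := by gcongr
      _ = M * (1 + K) * h := by field_simp
      _ ≤ _ := by gcongr; exact le_max_left _ _
  · obtain ⟨f, hf, hfJ, hfd⟩ := hder e
    have hd : ∀ a, DifferentiableAt ℝ (S.shape a) x₀ := fun a =>
      (hc a).differentiableAt one_ne_zero
    set b : S.Index → ℝ := fun a => S.shape a x₀ * inner ℝ (S.node a - x₀) f with hb
    have e1 : fderiv ℝ (S.interpolant v) x₀ e = ∑ a, v (S.node a) * ((h ^ 2)⁻¹ * b a) := by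
      have h1 : HasFDerivAt (S.interpolant v)
          (∑ a, v (S.node a) • fderiv ℝ (S.shape a) x₀) x₀ :=
        HasFDerivAt.fun_sum fun a _ => (hd a).hasFDerivAt.const_mul (v (S.node a))
      rw [h1.fderiv]
      simp [hfd, hb]
    have e2 : ∑ a, b a = 0 := by
      have h1 : ∑ a, S.shape a x₀ • (S.node a - x₀) = 0 := by
        simp only [smul_sub, Finset.sum_sub_distrib]
        rw [hwx, ← Finset.sum_smul, hw1, one_smul, sub_self]
      have h2 : ∑ a, b a = inner ℝ (∑ a, S.shape a x₀ • (S.node a - x₀)) f := by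
        rw [sum_inner]
        simp [hb, real_inner_smul_left]
      rw [h2, h1, inner_zero_left]
    have e3 : ∑ a, b a * fderiv ℝ v x₀ (S.node a - x₀) = h ^ 2 * fderiv ℝ v x₀ e := by
      have h1 := congrArg (fderiv ℝ v x₀) hfJ
      simpa only [map_sum, map_smul, smul_eq_mul] using h1
    -- The coefficients `b` have sum 0 and first moment `h² e`, so subtracting the first-order
    -- Taylor polynomial leaves exactly the error. The factor `‖x_a - x₀‖` in `b` times the
    -- quadratic remainder gives the third moment.
    have e4 : fderiv ℝ (S.interpolant v) x₀ e - fderiv ℝ v x₀ e = (h ^ 2)⁻¹ *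
        ∑ a, b a * (v (S.node a) - v x₀ - fderiv ℝ v x₀ (S.node a - x₀)) := by
      simp only [mul_sub, Finset.sum_sub_distrib, ← Finset.sum_mul]
      rw [e2, e3, e1, Finset.mul_sum]
      have h1 : ∀ a, v (S.node a) * ((h ^ 2)⁻¹ * b a) = (h ^ 2)⁻¹ * (b a * v (S.node a)) :=
        fun a => by ring
      simp only [h1]
      rw [inv_mul_cancel_left₀ (by positivity)]
      ring
    rw [e4, abs_mul, abs_of_pos (by positivity)]
    calc (h ^ 2)⁻¹ * |∑ a, b a * (v (S.node a) - v x₀ - fderiv ℝ v x₀ (S.node a - x₀))|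
        ≤ (h ^ 2)⁻¹ * ∑ a, S.shape a x₀ * ‖S.node a - x₀‖ ^ 3 * (‖f‖ * M) := by
          gcongr
          refine (Finset.abs_sum_le_sum_abs _ _).trans (Finset.sum_le_sum fun a _ => ?_)
          rw [abs_mul, hb, abs_mul, abs_of_nonneg (hw0 a)]
          have h1 := abs_real_inner_le_norm (S.node a - x₀) f
          have h2 := hM2 x₀ (S.node a)
          have h3 := hw0 a
          calc _ ≤ S.shape a x₀ * (‖S.node a - x₀‖ * ‖f‖) * (M * ‖S.node a - x₀‖ ^ 2) := by
                gcongr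
            _ = _ := by ring
      _ = (h ^ 2)⁻¹ * ((∑ a, S.shape a x₀ * ‖S.node a - x₀‖ ^ 3) * (‖f‖ * M)) := by
          rw [Finset.sum_mul]
      _ ≤ (h ^ 2)⁻¹ * (K * h ^ 3 * (K * ‖e‖ * M)) := by gcongr
      _ = M * K * K * h * ‖e‖ := by field_simp
      _ ≤ _ := by gcongr; exact le_max_right _ _

/-! ### Weak derivatives of the approximants and conclusion. -/

/-- Nothing is known of `U` outside `Ω`, but the support of the test function is compact in `Ω`. The
integrals therefore extend to the whole space, where integration by parts uses differentiability of
`U` only on that support. -/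
theorem hasWeakPartialDeriv_of_contDiffAt {d : ℕ} {Ω : Set (Space d)} (hΩ : IsOpen Ω)
    {U : Space d → ℝ} (hU : ∀ x ∈ Ω, ContDiffAt ℝ 1 U x) (i : Fin d) :
    HasWeakPartialDeriv Ω i U fun x => fderiv ℝ U x (EuclideanSpace.single i 1) := by
  have hUc : ContinuousOn U Ω := fun x hx => (hU x hx).continuousAt.continuousWithinAt
  have hdc : ContinuousOn (fun x => fderiv ℝ U x (EuclideanSpace.single i 1)) Ω := fun x hx =>
    (((hU x hx).fderiv_right (m := 0) (by simp)).continuousAt.clm_apply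
      continuousAt_const).continuousWithinAt
  refine ⟨hUc.locallyIntegrableOn hΩ.measurableSet, hdc.locallyIntegrableOn hΩ.measurableSet,
    fun φ hφ hφc hφΩ => ?_⟩
  have hint : ∀ f k : Space d → ℝ, ContinuousOn f Ω → Continuous k → tsupport k ⊆ tsupport φ →
      Integrable (fun x => f x * k x) volume := by
    intro f k hf hk hks
    have hsupp : Function.support (fun x => f x * k x) ⊆ tsupport φ := fun x hx =>
      hks (subset_tsupport _ (right_ne_zero_of_mul hx))
    rw [← integrableOn_iff_integrable_of_support_subset hsupp]
    exact ((hf.mono hφΩ).mul hk.continuousOn).integrableOn_compact hφc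
  have hφd : Continuous fun x => fderiv ℝ φ x (EuclideanSpace.single i 1) :=
    (hφ.continuous_fderiv (by simp)).clm_apply continuous_const
  have hts : tsupport (fun x => fderiv ℝ φ x (EuclideanSpace.single i 1)) ⊆ tsupport φ :=
    tsupport_fderiv_apply_subset ℝ _
  have key := integral_mul_fderiv_eq_neg_fderiv_mul_of_integrable (μ := volume)
    (v := EuclideanSpace.single i 1) (hint _ φ hdc hφ.continuous subset_rfl)
    (hint U _ hUc hφd hts) (hint U φ hUc hφ.continuous subset_rfl)
    (fun x hx => (hU x (hφΩ hx)).differentiableAt one_ne_zero)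
    (fun x _ => hφ.differentiable (by simp) x)
  rw [setIntegral_eq_integral_of_forall_compl_eq_zero fun x hx => ?_,
    setIntegral_eq_integral_of_forall_compl_eq_zero fun x hx => ?_, key]
  · rw [image_eq_zero_of_notMem_tsupport fun h => hx (hφΩ h), mul_zero]
  · have : x ∉ tsupport fun x => fderiv ℝ φ x (EuclideanSpace.single i 1) :=
      fun h => hx (hφΩ (hts h))
    have h0 : fderiv ℝ φ x (EuclideanSpace.single i 1) = 0 :=
      image_eq_zero_of_notMem_tsupport (f := fun x => fderiv ℝ φ x (EuclideanSpace.single i 1)) this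
    rw [h0, mul_zero]

theorem HasWeakPartialDeriv.sub {d : ℕ} {Ω : Set (Space d)} {i : Fin d} {u₁ g₁ u₂ g₂ : Space d → ℝ}
    (h₁ : HasWeakPartialDeriv Ω i u₁ g₁) (h₂ : HasWeakPartialDeriv Ω i u₂ g₂)
    (hu₁ : IntegrableOn u₁ Ω volume) (hg₁ : IntegrableOn g₁ Ω volume)
    (hu₂ : IntegrableOn u₂ Ω volume) (hg₂ : IntegrableOn g₂ Ω volume) :
    HasWeakPartialDeriv Ω i (fun x => u₁ x - u₂ x) (fun x => g₁ x - g₂ x) := by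
  refine ⟨h₁.1.sub h₂.1, h₁.2.1.sub h₂.2.1, fun φ hφ hφc hφΩ => ?_⟩
  have hφd : Continuous fun x => fderiv ℝ φ x (EuclideanSpace.single i 1) :=
    (hφ.continuous_fderiv (by simp)).clm_apply continuous_const
  have hφd' := hφc.fderiv_apply ℝ (EuclideanSpace.single i (1 : ℝ))
  have e1 := h₁.2.2 φ hφ hφc hφΩ
  have e2 := h₂.2.2 φ hφ hφc hφΩ
  simp only [sub_mul]
  rw [integral_sub (integrable_mul_of_continuous_hasCompactSupport hu₁ hφd hφd')
      (integrable_mul_of_continuous_hasCompactSupport hu₂ hφd hφd'),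
    integral_sub (integrable_mul_of_continuous_hasCompactSupport hg₁ hφ.continuous hφc)
      (integrable_mul_of_continuous_hasCompactSupport hg₂ hφ.continuous hφc), e1, e2]
  ring

/-- Any particular weak derivative bounds the infimum from above, so uniqueness of weak derivatives
is not needed. -/
theorem eW1pNorm_le {d : ℕ} {Ω : Set (Space d)} {p : ℝ≥0∞} (hp : 0 < p.toReal)
    {u : Space d → ℝ} {g : Fin d → Space d → ℝ} (hg : ∀ i, HasWeakPartialDeriv Ω i u (g i))
    {η : ℝ≥0∞} (hu : eLpNorm u p (volume.restrict Ω) ≤ η)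
    (hgη : ∀ i, eLpNorm (g i) p (volume.restrict Ω) ≤ η) :
    eW1pNorm Ω p u ≤ ((d + 1 : ℕ) : ℝ≥0∞) ^ (1 / p.toReal) * η := by
  have h1 : eLpNorm u p (volume.restrict Ω) ^ p.toReal +
      ∑ i : Fin d, (⨅ (g : Space d → ℝ) (_ : HasWeakPartialDeriv Ω i u g),
        eLpNorm g p (volume.restrict Ω)) ^ p.toReal ≤ ((d + 1 : ℕ) : ℝ≥0∞) * η ^ p.toReal := by
    calc _ ≤ η ^ p.toReal + ∑ _i : Fin d, η ^ p.toReal := by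
          gcongr with i
          exact (iInf₂_le (g i) (hg i)).trans (hgη i)
      _ = _ := by
          rw [Finset.sum_const, Finset.card_univ, Fintype.card_fin, nsmul_eq_mul]
          push_cast
          ring
  refine (ENNReal.rpow_le_rpow h1 (by positivity)).trans (le_of_eq ?_)
  rw [ENNReal.mul_rpow_of_nonneg _ _ (by positivity), ← ENNReal.rpow_mul,
    mul_one_div_cancel hp.ne', ENNReal.rpow_one]

theorem eventually_closedBall_subset {d : ℕ} {Ω Ω' : Set (Space d)} (hΩ : IsBoundedDomain Ω)
    (hΩ' : IsOpen Ω') (hsub : closure Ω ⊆ Ω') {h : ℕ → ℝ} (hlim : Tendsto h atTop (𝓝 0)) :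
    ∀ᶠ k in atTop, ∀ x ∈ Ω, Metric.closedBall x (2 * h k) ⊆ Ω' := by
  obtain ⟨δ, hδ, hδ'⟩ := hΩ.2.isCompact_closure.exists_cthickening_subset_open hΩ' hsub
  have h2 : Tendsto (fun k => 2 * h k) atTop (𝓝 0) := by simpa using hlim.const_mul 2
  filter_upwards [h2.eventually (gt_mem_nhds hδ)] with k hk x hx
  refine ((Metric.closedBall_subset_closedBall hk.le).trans ?_).trans hδ'
  exact Metric.closedBall_subset_cthickening (subset_closure hx) δ

/-- Approximability in `W^{1,p}(Ω)` by the spaces of the LME schemes. -/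
theorem eventually_exists_approx {d : ℕ} {Ω Ω' : Set (Space d)}
    (hΩ : IsBoundedDomain Ω) (hseg : SegmentCondition Ω) (hΩ' : IsBoundedDomain Ω')
    (hsub : closure Ω ⊆ Ω') {S : ℕ → ApproximationScheme d} {h : ℕ → ℝ} {γ τ : ℝ} (hγ : 0 < γ)
    (hh : ∀ k, 0 < h k) (hlim : Tendsto h atTop (𝓝 0))
    (hLME : ∀ k, (S k).IsLME (γ / h k ^ 2) Ω')
    (hcov : ∀ k, IsCovering (h k) (S k).points Ω') (hdens : ∀ k, (S k).HasDensityBound (h k) τ)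
    {p : ℝ≥0∞} (hp : 1 ≤ p) (hp' : p ≠ ⊤) {u : Space d → ℝ} (hu : MemW1p Ω p u)
    {ε : ℝ≥0∞} (hε : ε ≠ 0) :
    ∀ᶠ k in atTop, ∃ U ∈ (S k).space, MemW1p Ω p U ∧ eW1pNorm Ω p (fun x => U x - u x) ≤ ε := by
  have hpr : 0 < p.toReal := ENNReal.toReal_pos (zero_lt_one.trans_le hp).ne' hp'
  have hm : MeasurableSet Ω := hΩ.1.measurableSet
  have hfin : IsFiniteMeasure (volume.restrict Ω) := by
    rw [isFiniteMeasure_restrict]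
    exact hΩ.2.measure_lt_top.ne
  obtain ⟨hu0, hu1⟩ := hu
  choose g hug hg using hu1
  set c : ℝ≥0∞ := ((d + 1 : ℕ) : ℝ≥0∞) ^ (1 / p.toReal) with hc
  have hct : c ≠ ⊤ := ENNReal.rpow_ne_top_of_nonneg (by positivity) (ENNReal.natCast_ne_top _)
  -- One `η` is spent on smoothing and one on interpolation; `c` is the price of collecting `d + 1`
  -- terms in the norm.
  set η : ℝ≥0∞ := ε / c / 2 with hη
  have hη0 : η ≠ 0 := (ENNReal.div_pos (ENNReal.div_pos hε hct).ne' (by simp)).ne'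
  have hηε : c * (η + η) ≤ ε := by
    rw [hη, ENNReal.add_halves]
    exact ENNReal.mul_div_le
  obtain ⟨v, hv, hv', hvu, hvg⟩ := exists_smooth_approx hΩ hseg hp hp' hu0 hug hg hη0
  obtain ⟨C, hC⟩ := exists_interpolant_bounds hγ τ hv hv'
  -- On the bounded set `Ω` a uniform error `C h` costs at most `|Ω|^{1/p} C h` in `L^p`.
  have hsmall : Tendsto (fun k => (volume.restrict Ω) Set.univ ^ p.toReal⁻¹ *
      ENNReal.ofReal (C * h k)) atTop (𝓝 0) := by
    have h1 : Tendsto (fun k => ENNReal.ofReal (C * h k)) atTop (𝓝 0) := by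
      simpa using ENNReal.tendsto_ofReal (hlim.const_mul C)
    have h2 := ENNReal.Tendsto.const_mul (a := (volume.restrict Ω) Set.univ ^ p.toReal⁻¹) h1
      (Or.inr (ENNReal.rpow_ne_top_of_nonneg (by positivity) (measure_ne_top _ _)))
    simpa using h2
  filter_upwards [eventually_closedBall_subset hΩ hΩ'.1 hsub hlim,
    hsmall.eventually (ge_mem_nhds hη0.bot_lt)] with k hk hkη
  set U := (S k).interpolant v with hU
  have hb := fun x (hx : x ∈ Ω) => hC (S k) (h k) Ω' x (hh k) (hk x hx) (hLME k) (hcov k) (hdens k)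
  have hUC : ∀ x ∈ Ω, ContDiffAt ℝ 1 U x := fun x hx => (hb x hx).1
  have hUw := hasWeakPartialDeriv_of_contDiffAt hΩ.1 hUC
  have hvd : ∀ i : Fin d, Continuous fun x => fderiv ℝ v x (EuclideanSpace.single i 1) := fun i =>
    (hv.continuous_fderiv (by simp)).clm_apply continuous_const
  have hvLp : MemLp v p (volume.restrict Ω) := hv.continuous.memLp_of_hasCompactSupport hv'
  have hvdLp : ∀ i : Fin d, MemLp (fun x => fderiv ℝ v x (EuclideanSpace.single i 1)) p
      (volume.restrict Ω) := fun i =>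
    (hvd i).memLp_of_hasCompactSupport (hv'.fderiv_apply ℝ _)
  have hUm : AEStronglyMeasurable U (volume.restrict Ω) :=
    ContinuousOn.aestronglyMeasurable
      (fun x hx => (hUC x hx).continuousAt.continuousWithinAt) hm
  have hUdm : ∀ i : Fin d, AEStronglyMeasurable
      (fun x => fderiv ℝ U x (EuclideanSpace.single i 1)) (volume.restrict Ω) := fun i =>
    ContinuousOn.aestronglyMeasurable (fun x hx =>
      (((hUC x hx).fderiv_right (m := 0) (by simp)).continuousAt.clm_apply
        continuousAt_const).continuousWithinAt) hm
  have hb0 : ∀ᵐ x ∂volume.restrict Ω, ‖U x - v x‖ ≤ C * h k := by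
    filter_upwards [ae_restrict_mem hm] with x hx using (hb x hx).2.1
  have hb1 : ∀ i : Fin d, ∀ᵐ x ∂volume.restrict Ω,
      ‖fderiv ℝ U x (EuclideanSpace.single i 1) - fderiv ℝ v x (EuclideanSpace.single i 1)‖ ≤
        C * h k := by
    intro i
    filter_upwards [ae_restrict_mem hm] with x hx
    simpa using (hb x hx).2.2 (EuclideanSpace.single i 1)
  have hULp : MemLp U p (volume.restrict Ω) := by
    have h1 := (MemLp.of_bound (p := p) (hUm.sub hvLp.1) _ hb0).add hvLp
    rwa [sub_add_cancel] at h1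
  have hUdLp : ∀ i : Fin d, MemLp (fun x => fderiv ℝ U x (EuclideanSpace.single i 1)) p
      (volume.restrict Ω) := by
    intro i
    have h1 := (MemLp.of_bound (p := p) ((hUdm i).sub (hvdLp i).1) _ (hb1 i)).add (hvdLp i)
    rwa [sub_add_cancel] at h1
  refine ⟨U, (S k).interpolant_mem_space v,
    ⟨hULp, fun i => ⟨_, hUw i, hUdLp i⟩⟩, ?_⟩
  have htri : ∀ f₁ f₂ f₃ : Space d → ℝ, MemLp f₁ p (volume.restrict Ω) →
      MemLp f₂ p (volume.restrict Ω) → MemLp f₃ p (volume.restrict Ω) →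
      (∀ᵐ x ∂volume.restrict Ω, ‖f₁ x - f₂ x‖ ≤ C * h k) →
      eLpNorm (fun x => f₂ x - f₃ x) p (volume.restrict Ω) ≤ η →
      eLpNorm (fun x => f₁ x - f₃ x) p (volume.restrict Ω) ≤ η + η := by
    intro f₁ f₂ f₃ h₁ h₂ h₃ h12 h23
    have e1 : (fun x => f₁ x - f₃ x) = (fun x => f₁ x - f₂ x) + fun x => f₂ x - f₃ x := by
      ext x
      simp
    rw [e1]
    refine (eLpNorm_add_le (h₁.1.sub h₂.1) (h₂.1.sub h₃.1) hp).trans (add_le_add ?_ h23)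
    exact (eLpNorm_le_of_ae_bound h12).trans hkη
  refine le_trans (eW1pNorm_le hpr (fun i => (hUw i).sub (hug i) (hULp.integrable hp)
    ((hUdLp i).integrable hp) (hu0.integrable hp) ((hg i).integrable hp))
    (htri U v u hULp hvLp hu0 hb0 hvu)
    (fun i => htri _ _ _ (hUdLp i) (hvdLp i) (hg i) (hb1 i) (hvg i))) hηε

/-- Zero serves as an admissible approximant for the early `k`, where balls of radius `2 h` may
leave `Ω'`. -/
theorem memW1p_zero {d : ℕ} {Ω : Set (Space d)} (hΩ : IsOpen Ω) (p : ℝ≥0∞) :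
    MemW1p Ω p (0 : Space d → ℝ) := by
  refine ⟨MemLp.zero, fun i => ⟨_, hasWeakPartialDeriv_of_contDiffAt hΩ
    (fun x _ => contDiffAt_const (c := (0 : ℝ))) i, ?_⟩⟩
  simp

/-- A sequence of sets of approximants that eventually come arbitrarily close admits a convergent
selection. -/
theorem exists_selection_tendsto_zero {α : Type*} {P : ℕ → α → Prop} {N : α → ℝ≥0∞}
    (hne : ∀ k, ∃ a, P k a) (hN : ∀ ε ≠ 0, ∀ᶠ k in atTop, ∃ a, P k a ∧ N a ≤ ε) :
    ∃ s : ℕ → α, (∀ k, P k (s k)) ∧ Tendsto (fun k => N (s k)) atTop (𝓝 0) := by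
  -- Choosing within `1 / (k + 1)` of the infimum makes one selection work for every `ε`. An
  -- infinite infimum is treated apart, as it leaves no strict inequality to use.
  have hsel : ∀ k : ℕ, ∃ a, P k a ∧ N a ≤ (⨅ (b : α) (_ : P k b), N b) + ((k : ℝ≥0∞) + 1)⁻¹ := by
    intro k
    by_cases htop : (⨅ (b : α) (_ : P k b), N b) = ⊤
    · obtain ⟨a, ha⟩ := hne k
      exact ⟨a, ha, by simp [htop]⟩
    · have h1 : (⨅ (b : α) (_ : P k b), N b) <
          (⨅ (b : α) (_ : P k b), N b) + ((k : ℝ≥0∞) + 1)⁻¹ :=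
        ENNReal.lt_add_right htop (by simp [ENNReal.add_eq_top])
      obtain ⟨a, h2⟩ := iInf_lt_iff.1 h1
      obtain ⟨ha, h3⟩ := iInf_lt_iff.1 h2
      exact ⟨a, ha, h3.le⟩
  choose s hs hs' using hsel
  refine ⟨s, hs, ?_⟩
  have h1 : Tendsto (fun k => ⨅ (b : α) (_ : P k b), N b) atTop (𝓝 0) := by
    rw [ENNReal.tendsto_nhds_zero]
    intro ε hε
    filter_upwards [hN ε hε.ne'] with k hk
    obtain ⟨a, ha, haε⟩ := hk
    exact (iInf₂_le a ha).trans haε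
  have h2 : Tendsto (fun k : ℕ => ((k : ℝ≥0∞) + 1)⁻¹) atTop (𝓝 0) := by
    have := (ENNReal.tendsto_inv_nat_nhds_zero).comp (tendsto_add_atTop_nat 1)
    simpa [Function.comp_def] using this
  exact tendsto_of_tendsto_of_tendsto_of_le_of_le tendsto_const_nhds
    (by simpa using h1.add h2) (fun _ => zero_le) hs'

end LME

theorem mainTheorem6 (d : ℕ) (Ω Ω' : Set (LME.Space d))
    (hΩ : LME.IsBoundedDomain Ω) (hseg : LME.SegmentCondition Ω)
    (hΩ' : LME.IsBoundedDomain Ω') (hsub : closure Ω ⊆ Ω')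
    (S : ℕ → LME.ApproximationScheme d) (h : ℕ → ℝ) (γ τ : ℝ) (hγ : 0 < γ) (hτ : 0 < τ)
    (hh : ∀ k, 0 < h k) (hlim : Tendsto h atTop (𝓝 0))
    (hLME : ∀ k, (S k).IsLME (γ / h k ^ 2) Ω')
    (hcov : ∀ k, LME.IsCovering (h k) (S k).points Ω')
    (hdens : ∀ k, (S k).HasDensityBound (h k) τ)
    (p : ℝ≥0∞) (hp : 1 ≤ p) (hp' : p ≠ ⊤)
    (u : LME.Space d → ℝ) (hu : LME.MemW1p Ω p u) :
    ∃ U : ℕ → LME.Space d → ℝ,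
      (∀ k, U k ∈ (S k).space) ∧ (∀ k, LME.MemW1p Ω p (U k)) ∧
      Tendsto (fun k => LME.eW1pNorm Ω p (fun x => U k x - u x)) atTop (𝓝 0) := by
  obtain ⟨U, hU, hlimU⟩ := LME.exists_selection_tendsto_zero
    (P := fun k U => U ∈ (S k).space ∧ LME.MemW1p Ω p U)
    (N := fun U => LME.eW1pNorm Ω p fun x => U x - u x)
    (fun k => ⟨0, Submodule.zero_mem _, LME.memW1p_zero hΩ.1 p⟩)
    (fun ε hε => (LME.eventually_exists_approx hΩ hseg hΩ' hsub hγ hh hlim hLME hcov hdens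
      hp hp' hu hε).mono fun k ⟨U, h1, h2, h3⟩ => ⟨U, ⟨h1, h2⟩, h3⟩)
  exact ⟨U, fun k => (hU k).1, fun k => (hU k).2, hlimU⟩
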